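/- A complex Banach algebra $B$ (not assumed unital) is called contractible if for every Banach $B$-bimodule $E$ every continuous derivation $D:B\to E$ (a bounded linear map with $D(ab)=D(a)\cdot b+a\cdot D(b)$ for all $a,b\in B$) is inner, that is, there is $z\in E$ with $D(a)=z\cdot a-a\cdot z$ for all $a\in B$. The second dual $B^{**}$ is regarded as a Banach algebra under the first Arens product $\square$, given by $\langle m\,\square\, n,f\rangle=\langle m,n\cdot f\rangle$, $\langle n\cdot f,a\rangle=\langle n,f\cdot a\rangle$, $\langle f\cdot a,b\rangle=\langle f,ab\rangle$ for $m,n\in B^{**}$, $f\in B^*$, $a,b\in B$. The set of characters of $B$, i.e. nonzero multiplicative continuous linear functionals $B\to\mathbb{C}$, is denoted by $\Delta(B)$. **Theorem.** Let $G$ be a locally compact (Hausdorff) group with left Haar measure $\mu$, let $A$ be a complex Banach algebra with $\Delta(A)\neq\emptyset$, and let $L^1(G,A)$ be the Banach algebra of (classes of) Bochner integrable functions $G\to A$ with the norm $\|f\|=\int_G\|f(t)\|\,d\mu(t)$ and the convolution product $(f*g)(x)=\int_G f(t)\,g(t^{-1}x)\,d\mu(t)$. Then: 1. $L^1(G,A)$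 is contractible if and only if $G$ is finite and $A$ is contractible. 2. $L^1(G,A)^{**}$ is contractible if and only if $G$ is finite and $A^{**}$ is contractible. -/

import Mathlib

open MeasureTheory
open scoped ENNReal

set_option linter.unusedSectionVars false

noncomputable section

/-! ### Banach bimodules and contractible Banach algebras -/

/-- A Banach `A`-bimodule structure on the Banach space `E`: bounded bilinear left and right
actions `left a x = a · x` and `right a x = x · a` of `A` on `E` which are associative and
commute with each other. -/
structure BanachBimodule (A : Type*) [NonUnitalNormedRing A] [NormedSpace ℂ A]
    (E : Type*) [NormedAddCommGroup E] [NormedSpace ℂ E] where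
  left : A →L[ℂ] E →L[ℂ] E
  right : A →L[ℂ] E →L[ℂ] E
  left_mul : ∀ (a b : A) (x : E), left (a * b) x = left a (left b x)
  right_mul : ∀ (a b : A) (x : E), right (a * b) x = right b (right a x)
  left_right : ∀ (a b : A) (x : E), left a (right b x) = right b (left a x)

/-- A bounded linear map `D : A → E` is a derivation if `D (ab) = D(a) · b + a · D(b)`. -/
def BanachBimodule.IsDerivation {A : Type*} [NonUnitalNormedRing A] [NormedSpace ℂ A]
    {E : Type*} [NormedAddCommGroup E] [NormedSpace ℂ E] (M : BanachBimodule A E)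
    (D : A →L[ℂ] E) : Prop :=
  ∀ a b : A, D (a * b) = M.right b (D a) + M.left a (D b)

/-- `D` is inner if there is `z ∈ E` with `D a = z · a - a · z` for all `a ∈ A`. -/
def BanachBimodule.IsInner {A : Type*} [NonUnitalNormedRing A] [NormedSpace ℂ A]
    {E : Type*} [NormedAddCommGroup E] [NormedSpace ℂ E] (M : BanachBimodule A E)
    (D : A →L[ℂ] E) : Prop :=
  ∃ z : E, ∀ a : A, D a = M.right a z - M.left a z

/-- A Banach algebra `A` is contractible if every continuous derivation from `A` into a
Banach `A`-bimodule is inner. (The bimodules range over the universe of `A`; this is no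
restriction, since the bimodules that decide contractibility are built from `A` itself.) -/
def IsContractibleAlgebra.{u} (A : Type u) [NonUnitalNormedRing A] [NormedSpace ℂ A] : Prop :=
  ∀ (E : Type u) [NormedAddCommGroup E] [NormedSpace ℂ E] [CompleteSpace E]
    (M : BanachBimodule A E) (D : A →L[ℂ] E), M.IsDerivation D → M.IsInner D

/-! ### The second dual with the first Arens product -/

section Arens

variable (A : Type*) [NonUnitalNormedRing A] [NormedSpace ℂ A]

/-- The second dual `A**` of `A`. -/
def SecondDual : Type _ := StrongDual ℂ (StrongDual ℂ A)

instance : NormedAddCommGroup (SecondDual A) :=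
  inferInstanceAs (NormedAddCommGroup (StrongDual ℂ (StrongDual ℂ A)))

instance : NormedSpace ℂ (SecondDual A) :=
  inferInstanceAs (NormedSpace ℂ (StrongDual ℂ (StrongDual ℂ A)))

instance : CompleteSpace (SecondDual A) :=
  inferInstanceAs (CompleteSpace (StrongDual ℂ (StrongDual ℂ A)))

variable {A} [IsScalarTower ℂ A A] [SMulCommClass ℂ A A]

/-- `f · a ∈ A*` for `f ∈ A*` and `a ∈ A`: `⟨f · a, b⟩ = ⟨f, ab⟩`. -/
def dualAct (f : StrongDual ℂ A) (a : A) : StrongDual ℂ A :=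
  f.comp (ContinuousLinearMap.mul ℂ A a)

theorem dualAct_apply (f : StrongDual ℂ A) (a b : A) : dualAct f a b = f (a * b) := rfl

theorem norm_dualAct_le (f : StrongDual ℂ A) (a : A) : ‖dualAct f a‖ ≤ ‖f‖ * ‖a‖ :=
  (f.opNorm_comp_le _).trans
    (mul_le_mul_of_nonneg_left (ContinuousLinearMap.opNorm_mul_apply_le ℂ A a) (norm_nonneg f))

/-- `n · f ∈ A*` for `n ∈ A**` and `f ∈ A*`: `⟨n · f, a⟩ = ⟨n, f · a⟩`. -/
def bidualAct (n : StrongDual ℂ (StrongDual ℂ A)) (f : StrongDual ℂ A) : StrongDual ℂ A :=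
  LinearMap.mkContinuous
    { toFun := fun a => n (dualAct f a)
      map_add' := fun a b => by
        rw [← map_add]; congr 1; ext c; simp [dualAct_apply, add_mul]
      map_smul' := fun r a => by
        rw [← map_smul]; congr 1; ext c; simp [dualAct_apply, smul_mul_assoc] }
    (‖n‖ * ‖f‖) (fun a => by
      refine (n.le_opNorm _).trans ?_
      rw [mul_assoc]
      exact mul_le_mul_of_nonneg_left (norm_dualAct_le f a) (norm_nonneg n))

theorem bidualAct_apply (n : StrongDual ℂ (StrongDual ℂ A)) (f : StrongDual ℂ A) (a : A) :
    bidualAct n f a = n (dualAct f a) := rfl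

theorem norm_bidualAct_le (n : StrongDual ℂ (StrongDual ℂ A)) (f : StrongDual ℂ A) :
    ‖bidualAct n f‖ ≤ ‖n‖ * ‖f‖ :=
  LinearMap.mkContinuous_norm_le _ (by positivity) _

theorem bidualAct_add_right (n : StrongDual ℂ (StrongDual ℂ A)) (f g : StrongDual ℂ A) :
    bidualAct n (f + g) = bidualAct n f + bidualAct n g :=
  ContinuousLinearMap.ext fun a => map_add n (dualAct f a) (dualAct g a)

theorem bidualAct_smul_right (n : StrongDual ℂ (StrongDual ℂ A)) (r : ℂ) (f : StrongDual ℂ A) :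
    bidualAct n (r • f) = r • bidualAct n f :=
  ContinuousLinearMap.ext fun a => map_smul n r (dualAct f a)

/-- The first Arens product `m □ n` on `A**`: `⟨m □ n, f⟩ = ⟨m, n · f⟩`. -/
def arensMul (m n : StrongDual ℂ (StrongDual ℂ A)) : StrongDual ℂ (StrongDual ℂ A) :=
  LinearMap.mkContinuous
    { toFun := fun f => m (bidualAct n f)
      map_add' := fun f g => by rw [bidualAct_add_right, map_add]
      map_smul' := fun r f => by rw [bidualAct_smul_right, map_smul, RingHom.id_apply] }
    (‖m‖ * ‖n‖) (fun f => by
      refine (m.le_opNorm _).trans ?_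
      rw [mul_assoc]
      exact mul_le_mul_of_nonneg_left (norm_bidualAct_le n f) (norm_nonneg m))

theorem arensMul_apply (m n : StrongDual ℂ (StrongDual ℂ A)) (f : StrongDual ℂ A) :
    arensMul m n f = m (bidualAct n f) := rfl

theorem norm_arensMul_le (m n : StrongDual ℂ (StrongDual ℂ A)) :
    ‖arensMul m n‖ ≤ ‖m‖ * ‖n‖ :=
  LinearMap.mkContinuous_norm_le _ (by positivity) _

theorem arensMul_add (m n p : StrongDual ℂ (StrongDual ℂ A)) :
    arensMul m (n + p) = arensMul m n + arensMul m p :=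
  ContinuousLinearMap.ext fun f => map_add m (bidualAct n f) (bidualAct p f)

theorem arensMul_smul (r : ℂ) (m n : StrongDual ℂ (StrongDual ℂ A)) :
    arensMul m (r • n) = r • arensMul m n :=
  ContinuousLinearMap.ext fun f => map_smul m r (bidualAct n f)

theorem arensMul_zero (m : StrongDual ℂ (StrongDual ℂ A)) : arensMul m 0 = 0 :=
  ContinuousLinearMap.ext fun _ => map_zero m

theorem arensMul_assoc (m n p : StrongDual ℂ (StrongDual ℂ A)) :
    arensMul (arensMul m n) p = arensMul m (arensMul n p) := by
  have h1 (f : StrongDual ℂ A) (a b : A) : dualAct f (a * b) = dualAct (dualAct f a) b :=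
    ContinuousLinearMap.ext fun c => by simp [dualAct_apply, mul_assoc]
  have h2 (f : StrongDual ℂ A) (a : A) : dualAct (bidualAct p f) a = bidualAct p (dualAct f a) :=
    ContinuousLinearMap.ext fun b => by simp [dualAct_apply, bidualAct_apply, h1]
  refine ContinuousLinearMap.ext fun f => ?_
  rw [arensMul_apply, arensMul_apply, arensMul_apply]
  congr 1
  exact ContinuousLinearMap.ext fun a => by
    rw [bidualAct_apply, bidualAct_apply, arensMul_apply, h2]

/-- The second dual of a Banach algebra is a Banach algebra under the first Arens product. -/
instance : NonUnitalNormedRing (SecondDual A) where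
  __ := (inferInstance : NormedAddCommGroup (SecondDual A))
  mul := arensMul
  left_distrib := arensMul_add
  right_distrib _ _ _ := rfl
  zero_mul _ := rfl
  mul_zero := arensMul_zero
  mul_assoc := arensMul_assoc
  norm_mul_le := norm_arensMul_le

instance : IsScalarTower ℂ (SecondDual A) (SecondDual A) := ⟨fun _ _ _ => rfl⟩

instance : SMulCommClass ℂ (SecondDual A) (SecondDual A) :=
  ⟨fun r m n => (arensMul_smul r m n).symm⟩

end Arens

/-! ### The Banach algebra `L¹(G, A)` -/

section L1

variable {G : Type*} [Group G] [TopologicalSpace G] [IsTopologicalGroup G]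
  [LocallyCompactSpace G] [MeasurableSpace G] [BorelSpace G]
  (μ : Measure G)
  (A : Type*) [NonUnitalNormedRing A] [NormedSpace ℂ A]

/-- `L¹(G, A)`: (classes of) Bochner integrable functions `G → A` for the measure `μ`, with
the norm `‖f‖ = ∫ ‖f(t)‖ dμ(t)`. -/
def L1Alg : Type _ := Lp A 1 μ

instance : NormedAddCommGroup (L1Alg μ A) := inferInstanceAs (NormedAddCommGroup (Lp A 1 μ))

instance : NormedSpace ℂ (L1Alg μ A) := inferInstanceAs (NormedSpace ℂ (Lp A 1 μ))

instance [CompleteSpace A] : CompleteSpace (L1Alg μ A) :=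
  inferInstanceAs (CompleteSpace (Lp A 1 μ))

variable {μ A} [μ.IsHaarMeasure] [μ.Regular]

/-- Left translation on `L¹(G, A)`: `(leftTranslate t g)(x) = g (t⁻¹ x)`. -/
def leftTranslate (t : G) (g : Lp A 1 μ) : Lp A 1 μ := DomMulAct.mk t⁻¹ • g

theorem leftTranslate_ae (t : G) (g : Lp A 1 μ) :
    leftTranslate t g =ᵐ[μ] fun x => g (t⁻¹ * x) := DomMulAct.smul_Lp_ae_eq (DomMulAct.mk t⁻¹) g

theorem leftTranslate_mul (s t : G) (g : Lp A 1 μ) :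
    leftTranslate (s * t) g = leftTranslate s (leftTranslate t g) := by
  unfold leftTranslate
  rw [smul_smul]
  simp

theorem leftTranslate_add (t : G) (f g : Lp A 1 μ) :
    leftTranslate t (f + g) = leftTranslate t f + leftTranslate t g := smul_add _ _ _

theorem leftTranslate_smul (t : G) (c : ℂ) (g : Lp A 1 μ) :
    leftTranslate t (c • g) = c • leftTranslate t g := smul_comm _ _ _

theorem norm_leftTranslate (t : G) (g : Lp A 1 μ) : ‖leftTranslate t g‖ = ‖g‖ :=
  DomMulAct.norm_smul_Lp _ _

theorem continuous_leftTranslate (g : Lp A 1 μ) : Continuous fun t : G => leftTranslate t g := by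
  have : Fact ((1 : ℝ≥0∞) ≠ ∞) := ⟨ENNReal.one_ne_top⟩
  have h : Continuous fun t : G => (DomMulAct.mk t⁻¹ : Gᵈᵐᵃ) := by fun_prop
  exact h.smul continuous_const

/-- A continuous function is strongly measurable on sets of finite Haar measure. -/
theorem Continuous.aestronglyMeasurable_restrict_of_lt_top {E : Type*}
    [NormedAddCommGroup E] {h : G → E} (hh : Continuous h) {s : Set G} (hs : MeasurableSet s)
    (hμs : μ s < ∞) : AEStronglyMeasurable h (μ.restrict s) := by
  choose K hKs hK hKc hKμ using fun n : ℕ => hs.exists_isCompact_isClosed_sdiff_lt hμs.ne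
    (ε := ((n : ℝ≥0∞) + 1)⁻¹) (by simp)
  have hnull : μ (s \ ⋃ n, K n) = 0 := by
    refine le_antisymm (ge_of_tendsto' (x := Filter.atTop)
      (f := fun n : ℕ => ((n : ℝ≥0∞) + 1)⁻¹) ?_ fun n => ?_) zero_le
    · simpa using (Filter.tendsto_add_atTop_iff_nat 1).2 ENNReal.tendsto_inv_nat_nhds_zero
    · exact (measure_mono (Set.sdiff_subset_sdiff_right (Set.subset_iUnion K n))).trans (hKμ n).le
  have hae : s =ᵐ[μ] ⋃ n, K n :=
    (ae_le_set.2 hnull).antisymm (Set.iUnion_subset hKs).eventuallyLE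
  rw [Measure.restrict_congr_set hae, aestronglyMeasurable_iUnion_iff]
  exact fun n => hh.continuousOn.aestronglyMeasurable_of_isCompact (hK n) (hKc n).measurableSet

/-- If `f` is integrable and `h` is continuous and bounded, then `t ↦ B (f t) (h t)` is
integrable for every bounded bilinear `B`. No countability assumption on `G` is needed. -/
theorem integrable_bilin {E : Type*} [NormedAddCommGroup E] [NormedSpace ℂ E]
    (B : A →L[ℂ] E →L[ℂ] E) {f : G → A} (hf : Integrable f μ) {h : G → E} (hh : Continuous h)
    {C : ℝ} (hC : ∀ t, ‖h t‖ ≤ C) : Integrable (fun t => B (f t) (h t)) μ := by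
  have key : AEStronglyMeasurable (fun t => B (f t) (h t)) μ := by
    obtain ⟨f', ⟨fs, hfin, hlim⟩, hff'⟩ := hf.aefinStronglyMeasurable
    refine aestronglyMeasurable_of_tendsto_ae Filter.atTop
      (f := fun n t => B (fs n t) (h t)) (fun n => ?_) ?_
    · have hs := (fs n).measurableSet_support
      have : (fun t => B (fs n t) (h t)) =
          (Function.support (fs n)).indicator fun t => B (fs n t) (h t) := by
        refine (Set.indicator_eq_self.2 fun t ht h0 => ?_).symm
        simp [h0] at ht
      rw [this, aestronglyMeasurable_indicator_iff hs]
      exact B.aestronglyMeasurable_comp₂ (fs n).stronglyMeasurable.aestronglyMeasurable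
        (hh.aestronglyMeasurable_restrict_of_lt_top hs (hfin n))
    · filter_upwards [hff'] with t ht
      rw [ht]
      exact ((B.flip (h t)).continuous.tendsto _).comp (hlim t)
  refine Integrable.mono' (hf.norm.const_mul (‖B‖ * C)) key (Filter.Eventually.of_forall fun t => ?_)
  calc ‖B (f t) (h t)‖ ≤ ‖B‖ * ‖f t‖ * ‖h t‖ := B.le_opNorm₂ _ _
    _ ≤ ‖B‖ * ‖f t‖ * C := by gcongr; exact hC t
    _ = ‖B‖ * C * ‖f t‖ := by ring

variable [IsScalarTower ℂ A A] [SMulCommClass ℂ A A]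

/-- Pointwise left multiplication by `a ∈ A` on `L¹(G, A)`: `(leftMulL1 a g)(x) = a * g(x)`. -/
def leftMulL1 : A →L[ℂ] Lp A 1 μ →L[ℂ] Lp A 1 μ :=
  (ContinuousLinearMap.mul ℂ A).compLpL₂ 1 μ

theorem leftMulL1_ae (a : A) (g : Lp A 1 μ) : leftMulL1 a g =ᵐ[μ] fun x => a * g x :=
  ContinuousLinearMap.coeFn_compLp _ _

theorem norm_leftMulL1_le (a : A) (g : Lp A 1 μ) : ‖leftMulL1 a g‖ ≤ ‖a‖ * ‖g‖ :=
  ((ContinuousLinearMap.mul ℂ A a).norm_compLp_le g).trans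
    (mul_le_mul_of_nonneg_right (ContinuousLinearMap.opNorm_mul_apply_le ℂ A a) (norm_nonneg g))

theorem leftMulL1_mul (a b : A) (g : Lp A 1 μ) :
    leftMulL1 (a * b) g = leftMulL1 a (leftMulL1 b g) := by
  refine Lp.ext ?_
  filter_upwards [leftMulL1_ae (a * b) g, leftMulL1_ae b g, leftMulL1_ae a (leftMulL1 b g)]
    with x h1 h2 h3
  rw [h1, h3, h2, mul_assoc]

theorem leftTranslate_leftMulL1 (t : G) (a : A) (g : Lp A 1 μ) :
    leftTranslate t (leftMulL1 a g) = leftMulL1 a (leftTranslate t g) := by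
  refine Lp.ext ?_
  filter_upwards [leftTranslate_ae t (leftMulL1 a g), leftTranslate_ae t g,
    leftMulL1_ae a (leftTranslate t g),
    (measurePreserving_mul_left μ t⁻¹).quasiMeasurePreserving.ae (leftMulL1_ae a g)]
    with x h1 h2 h3 h4
  rw [h1, h3, h2, h4]

/-- The convolution `f * g = ∫ f(t) · (leftTranslate t g) dμ(t)`, a Bochner integral in `L¹(G, A)`
in which `f(t) · _` is pointwise left multiplication; in other words
`(f * g)(x) = ∫ f(t) g(t⁻¹ x) dμ(t)`. -/
def convL1 (f g : Lp A 1 μ) : Lp A 1 μ := ∫ t, leftMulL1 (f t) (leftTranslate t g) ∂μ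

theorem integrable_convL1 (f g : Lp A 1 μ) :
    Integrable (fun t => leftMulL1 (f t) (leftTranslate t g)) μ :=
  integrable_bilin (E := Lp A 1 μ) leftMulL1 (L1.integrable_coeFn f) (continuous_leftTranslate g)
    (fun t => (norm_leftTranslate t g).le)

theorem convL1_add (f g h : Lp A 1 μ) : convL1 f (g + h) = convL1 f g + convL1 f h := by
  unfold convL1
  rw [← integral_add (integrable_convL1 f g) (integrable_convL1 f h)]
  refine integral_congr_ae (Filter.Eventually.of_forall fun t => ?_)
  simp only [leftTranslate_add, map_add]

theorem add_convL1 (f g h : Lp A 1 μ) : convL1 (f + g) h = convL1 f h + convL1 g h := by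
  unfold convL1
  rw [← integral_add (integrable_convL1 f h) (integrable_convL1 g h)]
  refine integral_congr_ae ?_
  filter_upwards [Lp.coeFn_add f g] with t ht
  rw [ht, Pi.add_apply, map_add, add_apply]

theorem smul_convL1 (c : ℂ) (f g : Lp A 1 μ) : convL1 (c • f) g = c • convL1 f g := by
  unfold convL1
  rw [← integral_smul]
  refine integral_congr_ae ?_
  filter_upwards [Lp.coeFn_smul c f] with t ht
  rw [ht, Pi.smul_apply, map_smul, smul_apply]

theorem convL1_smul (c : ℂ) (f g : Lp A 1 μ) : convL1 f (c • g) = c • convL1 f g := by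
  unfold convL1
  rw [← integral_smul]
  refine integral_congr_ae (Filter.Eventually.of_forall fun t => ?_)
  simp only [leftTranslate_smul, map_smul]

theorem zero_convL1 (f : Lp A 1 μ) : convL1 0 f = 0 := by
  simpa using smul_convL1 (0 : ℂ) (0 : Lp A 1 μ) f

theorem convL1_zero (f : Lp A 1 μ) : convL1 f 0 = 0 := by
  simpa using convL1_smul (0 : ℂ) f (0 : Lp A 1 μ)

theorem norm_convL1_le (f g : Lp A 1 μ) : ‖convL1 f g‖ ≤ ‖f‖ * ‖g‖ := by
  rw [L1.norm_eq_integral_norm f, ← integral_mul_const]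
  refine norm_integral_le_of_norm_le ((L1.integrable_coeFn f).norm.mul_const _)
    (Filter.Eventually.of_forall fun t => ?_)
  exact (norm_leftMulL1_le _ _).trans_eq (by rw [norm_leftTranslate])

/-- Left translation as a bounded linear operator. -/
def leftTranslateL (t : G) : Lp A 1 μ →L[ℂ] Lp A 1 μ :=
  LinearMap.mkContinuous
    { toFun := leftTranslate t
      map_add' := leftTranslate_add t
      map_smul' := leftTranslate_smul t }
    1 (fun f => ((norm_leftTranslate t f).trans (one_mul _).symm).le)

/-- Convolution from the right as a bounded linear operator. -/
def convRightL (h : Lp A 1 μ) : Lp A 1 μ →L[ℂ] Lp A 1 μ :=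
  LinearMap.mkContinuous
    { toFun := fun f => convL1 f h
      map_add' := fun f g => add_convL1 f g h
      map_smul' := fun c f => smul_convL1 c f h }
    ‖h‖ (fun f => (norm_convL1_le f h).trans_eq (mul_comm _ _))

variable [CompleteSpace A]

theorem convL1_leftMul_translate (a : A) (t : G) (g h : Lp A 1 μ) :
    convL1 (leftMulL1 a (leftTranslate t g)) h = leftMulL1 a (leftTranslate t (convL1 g h)) := by
  have h1 : leftMulL1 a (leftTranslate t (convL1 g h)) =
      ∫ s, leftMulL1 a (leftTranslate t (leftMulL1 (g s) (leftTranslate s h))) ∂μ :=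
    (((leftMulL1 a).comp (leftTranslateL t)).integral_comp_comm (integrable_convL1 g h)).symm
  rw [h1, ← integral_mul_left_eq_self
    (fun s => leftMulL1 a (leftTranslate t (leftMulL1 (g s) (leftTranslate s h)))) t⁻¹]
  refine integral_congr_ae ?_
  filter_upwards [leftMulL1_ae a (leftTranslate t g), leftTranslate_ae t g] with s h2 h3
  rw [h2, h3, leftMulL1_mul, leftTranslate_leftMulL1, ← leftTranslate_mul, mul_inv_cancel_left]

theorem convL1_assoc (f g h : Lp A 1 μ) :
    convL1 (convL1 f g) h = convL1 f (convL1 g h) := by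
  have h1 : convL1 (convL1 f g) h =
      ∫ t, convL1 (leftMulL1 (f t) (leftTranslate t g)) h ∂μ :=
    ((convRightL h).integral_comp_comm (integrable_convL1 f g)).symm
  rw [h1]
  exact integral_congr_ae (Filter.Eventually.of_forall fun t => convL1_leftMul_translate _ _ _ _)

/-- The convolution, tested against measurable sets: integrating the pointwise formula
`(f * g)(x) = ∫ f(t) g(t⁻¹ x) dμ(t)` over `s` and exchanging the integrals gives this identity,
which determines `f * g`. -/
theorem setIntegral_convL1 (f g : Lp A 1 μ) (s : Set G) :
    ∫ x in s, convL1 f g x ∂μ = ∫ t, f t * ∫ x in s, g (t⁻¹ * x) ∂μ ∂μ := by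
  let I : Lp A 1 μ →L[ℂ] A := (L1.integralCLM' ℂ).comp (LpToLpRestrictCLM G A ℂ μ 1 s)
  have hI (u : Lp A 1 μ) : I u = ∫ x in s, u x ∂μ := by
    have h1 : I u = ∫ x in s, LpToLpRestrictCLM G A ℂ μ 1 s u x ∂μ := by
      rw [← L1.integral_eq_integral, L1.integral_eq' ℂ]
      rfl
    rw [h1]
    exact integral_congr_ae (LpToLpRestrictCLM_coeFn ℂ s u)
  rw [← hI]
  refine (I.integral_comp_comm (integrable_convL1 f g)).symm.trans ?_
  refine integral_congr_ae (Filter.Eventually.of_forall fun t => ?_)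
  have h2 : Integrable (fun x => g (t⁻¹ * x)) (μ.restrict s) :=
    ((L1.integrable_coeFn g).comp_mul_left t⁻¹).restrict
  refine (hI _).trans (Eq.trans ?_ ((ContinuousLinearMap.mul ℂ A (f t)).integral_comp_comm h2))
  refine integral_congr_ae (ae_restrict_of_ae ?_)
  filter_upwards [leftMulL1_ae (f t) (leftTranslate t g), leftTranslate_ae t g] with x h3 h4
  rw [h3, h4]
  rfl

/-- `L¹(G, A)` is a Banach algebra under convolution. -/
instance : NonUnitalNormedRing (L1Alg μ A) where
  __ := (inferInstance : NormedAddCommGroup (L1Alg μ A))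
  mul := convL1
  left_distrib := convL1_add
  right_distrib := add_convL1
  zero_mul := zero_convL1
  mul_zero := convL1_zero
  mul_assoc := convL1_assoc
  norm_mul_le := norm_convL1_le

instance : IsScalarTower ℂ (L1Alg μ A) (L1Alg μ A) := ⟨smul_convL1⟩

instance : SMulCommClass ℂ (L1Alg μ A) (L1Alg μ A) := ⟨fun c f g => (convL1_smul c f g).symm⟩

end L1

end

set_option linter.overlappingInstances false

noncomputable section

/-! ### Contractible algebras -/

/-! A contractible algebra has a left identity `e` and, for each character `Φ`, an element `w` with
`Φ w = 1` and `w * b = Φ b • w` (`exists_absorbing`). Let `φ` be a character of `A` and `Φ = φ ∘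
∫_G`. If `L¹(G, A)` or its second dual is contractible, such `e` and `w` exist in `L¹(G, A)**`, in
the first case through the canonical embedding. Together they force `G` to be finite
(`finite_of_bidual_elements`).

The element `w` forces compactness. In a noncompact group some open `S` is such that both `S` and
`Sᶜ` asymptotically contain right translates of every point, thickened by a fixed neighbourhood of
`1` (`exists_isOpen_alternating`). A weak-star cluster point `m` of bumps translated along `S`
satisfies `m · (φ ∘ ∫_S) = c Φ` with `c ≠ 0`, whence `w (φ ∘ ∫_S) = 1`. The same holds for `Sᶜ`,
although the two functionals add up to `Φ` and `w Φ = 1`.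

The element `e` forces a compact `G` to be discrete. Since `e □ m = m`, every `m` with `f □ m = 0`
for all `f` in `L¹` vanishes. Differences between bumps and their translates by `t → 1` have such
cluster points, so small translations move each measurable set by a null set. This fails for a dense
open set that is not of full measure (`exists_dense_isOpen_measure_lt`).

Contractibility descends to `A` and `A**` along integration over `G`, a surjective homomorphism with
a bounded linear section. Conversely, for finite `G` both algebras are spanned by copies of `A` or
`A**` multiplied as in a group algebra, and averaging over `G` makes derivations inner
(`of_finite_group`). -/

theorem exists_map_eq_one {E : Type*} [NormedAddCommGroup E] [NormedSpace ℂ E] {φ : E →L[ℂ] ℂ}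
    (hφ : φ ≠ 0) : ∃ x, φ x = 1 := by
  obtain ⟨x, hx⟩ := DFunLike.ne_iff.1 hφ
  exact ⟨(φ x)⁻¹ • x, by rw [map_smul, smul_eq_mul]; exact inv_mul_cancel₀ hx⟩

section Contractible

universe u v w

variable {A : Type u} [NonUnitalNormedRing A] [NormedSpace ℂ A]
  {E : Type v} [NormedAddCommGroup E] [NormedSpace ℂ E]

/-- The restriction of a bounded bilinear action to an invariant subspace. -/
def restrictAction (T : A →L[ℂ] E →L[ℂ] E) (p : Submodule ℂ E)
    (h : ∀ a, ∀ x ∈ p, T a x ∈ p) : A →L[ℂ] p →L[ℂ] p :=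
  LinearMap.mkContinuous₂
    (LinearMap.mk₂ ℂ (fun a (x : p) => (⟨T a x, h a x x.2⟩ : p))
      (fun _ _ _ => Subtype.ext (by simp)) (fun _ _ _ => Subtype.ext (by simp))
      (fun _ _ _ => Subtype.ext (by simp)) (fun _ _ _ => Subtype.ext (by simp)))
    ‖T‖ (fun a x => T.le_opNorm₂ a x)

theorem coe_restrictAction (T : A →L[ℂ] E →L[ℂ] E) (p : Submodule ℂ E)
    (h : ∀ a, ∀ x ∈ p, T a x ∈ p) (a : A) (x : p) :
    (restrictAction T p h a x : E) = T a x := rfl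

/-- The restriction of a Banach bimodule to an invariant subspace. -/
def BanachBimodule.restrict (M : BanachBimodule A E) (p : Submodule ℂ E)
    (hl : ∀ a, ∀ x ∈ p, M.left a x ∈ p) (hr : ∀ a, ∀ x ∈ p, M.right a x ∈ p) :
    BanachBimodule A p where
  left := restrictAction M.left p hl
  right := restrictAction M.right p hr
  left_mul _ _ _ := Subtype.ext (M.left_mul _ _ _)
  right_mul _ _ _ := Subtype.ext (M.right_mul _ _ _)
  left_right _ _ _ := Subtype.ext (M.left_right _ _ _)

/-- Transport of a Banach bimodule along a linear homeomorphism. -/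
def BanachBimodule.transport {F : Type w} [NormedAddCommGroup F] [NormedSpace ℂ F]
    (M : BanachBimodule A E) (e : E ≃L[ℂ] F) : BanachBimodule A F where
  left := (ContinuousLinearEquiv.arrowCongr e e : (E →L[ℂ] E) →L[ℂ] (F →L[ℂ] F)).comp M.left
  right := (ContinuousLinearEquiv.arrowCongr e e : (E →L[ℂ] E) →L[ℂ] (F →L[ℂ] F)).comp M.right
  left_mul a b x := by simp [M.left_mul]
  right_mul a b x := by simp [M.right_mul]
  left_right a b x := by simp [M.left_right]

/-- Every point of the closure is the limit of a sequence in `s`, so the closure is covered by the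
image of the small type of such sequences. -/
theorem small_closure_of_small {X : Type v} [TopologicalSpace X] [FrechetUrysohnSpace X]
    [T2Space X] (s : Set X) [Small.{u} s] : Small.{u} (closure s) := by
  have h : closure s ⊆ Set.range (fun f : ℕ → Shrink.{u} s =>
      @Filter.limUnder _ _ _ (⟨((equivShrink s).symm (f 0)).1⟩ : Nonempty X) Filter.atTop
        fun n => ((equivShrink s).symm (f n)).1) := by
    intro x hx
    obtain ⟨y, hy, hyx⟩ := mem_closure_iff_seq_limit.1 hx
    refine ⟨fun n => equivShrink s ⟨y n, hy n⟩, ?_⟩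
    simpa using hyx.limUnder_eq
  exact small_subset h

/-- Contractibility is tested by bimodules in every universe. -/
theorem IsContractibleAlgebra.isInner (hA : IsContractibleAlgebra A) [CompleteSpace E]
    (M : BanachBimodule A E) (D : A →L[ℂ] E) (hD : M.IsDerivation D) : M.IsInner D := by
  -- The closed span of `s` is a sub-bimodule containing the values of `D`, because `a · D b = D (a
  -- * b) - D a · b`. It is small relative to the universe of `A`, hence isometric to a bimodule in
  -- that universe.
  let s : Set E := Set.range D ∪ Set.range fun x : A × A => M.right x.1 (D x.2)
  have : Small.{u} s := small_union ..
  let p := (Submodule.span ℂ s).topologicalClosure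
  have : Small.{u} ℂ := inferInstance
  have hsp : Small.{u} (Submodule.span ℂ s) := Submodule.small_span s
  have hp : Small.{u} p := small_closure_of_small (Submodule.span ℂ s : Set E)
  have hs : ∀ x ∈ s, x ∈ Submodule.span ℂ s := fun x hx => Submodule.subset_span hx
  have key (T : E →L[ℂ] E) (hT : ∀ x ∈ s, T x ∈ Submodule.span ℂ s) : ∀ x ∈ p, T x ∈ p := by
    intro x hx
    refine map_mem_closure T.continuous hx fun y hy => ?_
    exact (Submodule.span_le (p := (Submodule.span ℂ s).comap (T : E →ₗ[ℂ] E))).2 hT hy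
  have h1 (a b : A) : M.left a (D b) ∈ Submodule.span ℂ s := by
    have : M.left a (D b) = D (a * b) - M.right b (D a) := by rw [hD]; abel
    rw [this]
    exact sub_mem (hs _ (Or.inl ⟨_, rfl⟩)) (hs _ (Or.inr ⟨(b, a), rfl⟩))
  have hr : ∀ a, ∀ x ∈ p, M.right a x ∈ p := by
    refine fun a => key _ ?_
    rintro _ (⟨b, rfl⟩ | ⟨⟨c, b⟩, rfl⟩)
    · exact hs _ (Or.inr ⟨(a, b), rfl⟩)
    · exact hs _ (Or.inr ⟨(c * a, b), M.right_mul _ _ _⟩)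
  have hl : ∀ a, ∀ x ∈ p, M.left a x ∈ p := by
    refine fun a => key _ ?_
    rintro _ (⟨b, rfl⟩ | ⟨⟨c, b⟩, rfl⟩)
    · exact h1 a b
    · have : M.left a (M.right c (D b)) = M.right c (D (a * b)) - M.right (b * c) (D a) := by
        rw [M.left_right, hD, map_add, M.right_mul]; abel
      show M.left a (M.right c (D b)) ∈ _
      rw [this]
      exact sub_mem (hs _ (Or.inr ⟨(c, a * b), rfl⟩)) (hs _ (Or.inr ⟨(b * c, a), rfl⟩))
  have hpc : CompleteSpace p := (Submodule.isClosed_topologicalClosure _).completeSpace_coe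
  let e0 : p ≃ₗ[ℂ] Shrink.{u} p := (Shrink.linearEquiv ℂ p).symm
  let e : p ≃ₗᵢ[ℂ] Shrink.{u} p :=
    { e0 with norm_map' := fun x => congrArg norm ((equivShrink p).symm_apply_apply x) }
  have : CompleteSpace (Shrink.{u} p) :=
    (completeSpace_congr e.symm.isometry.isUniformEmbedding).2 hpc
  let D₀ : A →L[ℂ] p := D.codRestrict p fun a =>
    Submodule.le_topologicalClosure _ (hs _ (Or.inl ⟨a, rfl⟩))
  let e' := e.toContinuousLinearEquiv
  obtain ⟨z, hz⟩ := hA _ ((M.restrict p hl hr).transport e') (e'.toContinuousLinearMap.comp D₀)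
    (fun a b => by
      have : D₀ (a * b) = restrictAction M.right p hr b (D₀ a)
        + restrictAction M.left p hl a (D₀ b) := Subtype.ext (hD a b)
      simp [BanachBimodule.transport, BanachBimodule.restrict, this])
  refine ⟨(e'.symm z : p), fun a => ?_⟩
  have h2 := congrArg (fun y => ((e'.symm y : p) : E)) (hz a)
  simpa [BanachBimodule.transport, BanachBimodule.restrict, coe_restrictAction, D₀] using h2

/-- The image of a contractible algebra is contractible. -/
theorem IsContractibleAlgebra.of_surjective {B : Type w} [NonUnitalNormedRing B] [NormedSpace ℂ B]
    (hB : IsContractibleAlgebra B) (θ : B →L[ℂ] A) (hθ : ∀ a b, θ (a * b) = θ a * θ b)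
    (hs : Function.Surjective θ) : IsContractibleAlgebra A := by
  intro E _ _ _ M D hD
  let M' : BanachBimodule B E :=
    { left := M.left.comp θ
      right := M.right.comp θ
      left_mul := fun a b x => by simp [hθ, M.left_mul]
      right_mul := fun a b x => by simp [hθ, M.right_mul]
      left_right := fun a b x => by simp [M.left_right] }
  obtain ⟨z, hz⟩ := hB.isInner M' (D.comp θ) fun a b => by
    show D (θ (a * b)) = _
    rw [hθ, hD]; rfl
  refine ⟨z, fun a => ?_⟩
  obtain ⟨b, rfl⟩ := hs a
  exact hz b

variable [IsScalarTower ℂ A A] [SMulCommClass ℂ A A] [CompleteSpace A]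

/-- When the right action is zero, the identity map is a derivation; an element implementing it is
the negative of a right identity. -/
theorem IsContractibleAlgebra.exists_right_identity (hA : IsContractibleAlgebra A) :
    ∃ e : A, ∀ a, a * e = a := by
  let M : BanachBimodule A A :=
    { left := ContinuousLinearMap.mul ℂ A
      right := 0
      left_mul := fun a b x => by simp [mul_assoc]
      right_mul := fun a b x => by simp
      left_right := fun a b x => by simp }
  obtain ⟨z, hz⟩ := hA A M (ContinuousLinearMap.id ℂ A) fun a b => by simp [M]
  refine ⟨-z, fun a => ?_⟩
  have := hz a
  simp only [M, ContinuousLinearMap.id_apply, ContinuousLinearMap.mul_apply', zero_apply,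
    zero_sub] at this
  rw [mul_neg, ← this]

theorem IsContractibleAlgebra.exists_left_identity (hA : IsContractibleAlgebra A) :
    ∃ e : A, ∀ a, e * a = a := by
  let M : BanachBimodule A A :=
    { left := 0
      right := (ContinuousLinearMap.mul ℂ A).flip
      left_mul := fun a b x => by simp
      right_mul := fun a b x => by simp [mul_assoc]
      left_right := fun a b x => by simp }
  obtain ⟨z, hz⟩ := hA A M (ContinuousLinearMap.id ℂ A) fun a b => by simp [M]
  refine ⟨z, fun a => ?_⟩
  have := hz a
  simp only [M, ContinuousLinearMap.id_apply, ContinuousLinearMap.flip_apply,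
    ContinuousLinearMap.mul_apply', zero_apply, sub_zero] at this
  exact this.symm

/-- A contractible algebra contains, for each character `Φ`, an element `w` with `Φ w = 1` on
which right multiplication acts through `Φ`. -/
theorem IsContractibleAlgebra.exists_absorbing (hA : IsContractibleAlgebra A)
    (Φ : A →L[ℂ] ℂ) (hΦ : ∀ a b, Φ (a * b) = Φ a * Φ b) (hne : Φ ≠ 0) :
    ∃ w : A, Φ w = 1 ∧ ∀ a, w * a = Φ a • w := by
  obtain ⟨e, he⟩ := exists_map_eq_one hne
  let M : BanachBimodule A A :=
    { left := (ContinuousLinearMap.lsmul ℂ ℂ).comp Φ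
      right := (ContinuousLinearMap.mul ℂ A).flip
      left_mul := fun a b x => by
        simp only [hΦ, mul_smul, ContinuousLinearMap.comp_apply, ContinuousLinearMap.lsmul_apply]
      right_mul := fun a b x => by simp [mul_assoc]
      left_right := fun a b x => by simp }
  let p : Submodule ℂ A := LinearMap.ker (Φ : A →ₗ[ℂ] ℂ)
  have hp (x : A) : x ∈ p ↔ Φ x = 0 := LinearMap.mem_ker
  have hpc : CompleteSpace p := by
    have : IsClosed (p : Set A) := Φ.isClosed_ker
    exact this.completeSpace_coe
  -- In `A` this derivation is implemented by `e`, but its values lie in `ker Φ`. Contractibility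
  -- gives a second implementing element `z` in `ker Φ`, and `e - z` is absorbing.
  let D : A →L[ℂ] A := ContinuousLinearMap.mul ℂ A e - Φ.smulRight e
  have hDa (a : A) : D a = e * a - Φ a • e := by simp [D]
  have hl : ∀ a, ∀ x ∈ p, M.left a x ∈ p := fun a x hx => by
    rw [hp] at hx ⊢; simp [M, hx]
  have hr : ∀ a, ∀ x ∈ p, M.right a x ∈ p := fun a x hx => by
    rw [hp] at hx ⊢; simp [M, hx, hΦ]
  let D₀ : A →L[ℂ] p := D.codRestrict p fun a => by
    rw [hp, hDa]; simp [hΦ, he]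
  obtain ⟨z, hz⟩ := hA p (M.restrict p hl hr) D₀ fun a b => Subtype.ext <| by
    show D (a * b) = D a * b + Φ a • D b
    simp only [hDa, hΦ, sub_mul, smul_sub, smul_mul_assoc, mul_assoc, mul_smul]
    abel
  have hz' (a : A) : e * a - Φ a • e = z * a - Φ a • (z : A) := by
    rw [← hDa]
    exact congrArg Subtype.val (hz a)
  refine ⟨e - z, ?_, fun a => ?_⟩
  · rw [map_sub, he, (hp z).1 z.2, sub_zero]
  · rw [sub_mul, smul_sub, sub_eq_sub_iff_sub_eq_sub, hz' a]

/-- If an algebra `B` is spanned by copies `ι t A` of a contractible algebra, indexed by a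
finite group and multiplied as in the group algebra, then `B` is contractible. -/
theorem IsContractibleAlgebra.of_finite_group (hA : IsContractibleAlgebra A)
    {G : Type w} [Group G] [Fintype G] {B : Type v} [NonUnitalNormedRing B] [NormedSpace ℂ B]
    (ι : G → A →L[ℂ] B) (hmul : ∀ s t a b, ι s a * ι t b = ι (s * t) (a * b))
    (hspan : ∀ b : B, ∃ f : G → A, b = ∑ t, ι t (f t)) : IsContractibleAlgebra B := by
  obtain ⟨e, he⟩ := hA.exists_right_identity
  have he' : ∀ a, e * a = a := by
    obtain ⟨e', he'⟩ := hA.exists_left_identity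
    have : e = e' := by rw [← he' e, he]
    rwa [this]
  intro E _ _ _ M D hD
  let M₁ : BanachBimodule A E :=
    { left := M.left.comp (ι 1)
      right := M.right.comp (ι 1)
      left_mul := fun a b x => by
        have := hmul 1 1 a b
        rw [one_mul] at this
        simp [← this, M.left_mul]
      right_mul := fun a b x => by
        have := hmul 1 1 a b
        rw [one_mul] at this
        simp [← this, M.right_mul]
      left_right := fun a b x => by simp [M.left_right] }
  obtain ⟨z, hz⟩ := hA.isInner M₁ (D.comp (ι 1)) fun a b => by
    have := hmul 1 1 a b
    rw [one_mul] at this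
    show D (ι 1 (a * b)) = _
    rw [← this, hD]; rfl
  replace hz (a : A) : D (ι 1 a) = M.right (ι 1 a) z - M.left (ι 1 a) z := hz a
  -- the derivation vanishing on `ι 1 A`
  let D' : B → E := fun b => D b - (M.right b z - M.left b z)
  have hD' (a b : B) : D' (a * b) = M.right b (D' a) + M.left a (D' b) := by
    have := hD a b
    simp only [D', this, map_sub, M.right_mul, M.left_mul, M.left_right]
    abel
  have hD1 (a : A) : D' (ι 1 a) = 0 := sub_eq_zero.2 (hz a)
  let u : G → B := fun t => ι t e
  have hu (s t : G) : u s * u t = u (s * t) := by simp only [u, hmul, he]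
  -- The elements `u t` commute with `ι 1 A`, so `D'`, which vanishes on `ι 1 A`, is determined on
  -- `ι t A` by its value at `u t`.
  have hul (t : G) (a : A) : u t * ι 1 a = ι t a := by simp only [u, hmul, he', mul_one]
  have hur (t : G) (a : A) : ι 1 a * u t = ι t a := by simp only [u, hmul, he, one_mul]
  have hD0 (t : G) (a : A) : D' (ι t a) = M.right (ι 1 a) (D' (u t)) := by
    rw [← hul, hD', hD1, map_zero, add_zero]
  have hD0' (t : G) (a : A) : D' (ι t a) = M.left (ι 1 a) (D' (u t)) := by
    rw [← hur, hD', hD1, map_zero, zero_add]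
  -- The average over `G` of `D' (u s) · u s⁻¹`; replacing `s` by `t * s` in the sum shows that it
  -- implements `D'` on the `u t`.
  let y : E := (Fintype.card G : ℂ)⁻¹ • ∑ s, M.right (u s⁻¹) (D' (u s))
  have hcard : (Fintype.card G : ℂ) ≠ 0 := by exact_mod_cast Fintype.card_ne_zero
  have hy (t : G) : D' (u t) = M.right (u t) y - M.left (u t) y := by
    have h1 (s : G) : M.left (u t) (M.right (u s⁻¹) (D' (u s))) =
        M.right (u t) (M.right (u (t * s)⁻¹) (D' (u (t * s)))) - D' (u t) := by
      rw [← M.right_mul, hu, mul_inv_rev, inv_mul_cancel_right, ← hu t s, hD', map_add,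
        M.left_right, ← M.right_mul, hu, mul_inv_cancel]
      -- The module is not assumed unital, but `u 1` does fix `D' (u t)`.
      have : M.right (u 1) (D' (u t)) = D' (u t) := (hD0 t e).symm
      rw [this]; abel
    have h2 : M.left (u t) y = M.right (u t) y - D' (u t) := by
      simp only [y, map_smul, map_sum, h1, Finset.sum_sub_distrib, smul_sub, Finset.sum_const,
        Finset.card_univ]
      rw [← Nat.cast_smul_eq_nsmul ℂ, smul_smul, inv_mul_cancel₀ hcard, one_smul]
      congr 2
      exact Equiv.sum_comp (Equiv.mulLeft t) fun s => M.right (u t) (M.right (u s⁻¹) (D' (u s)))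
    rw [h2]; abel
  -- Each `D' (u s)` commutes with `ι 1 A`, because `D' (ι s a)` can be computed from either side.
  have hyc (a : A) : M.left (ι 1 a) y = M.right (ι 1 a) y := by
    simp only [y, map_smul, map_sum]
    congr 1
    refine Finset.sum_congr rfl fun s _ => ?_
    rw [M.left_right, ← hD0', hD0, ← M.right_mul, ← M.right_mul, hul, hur]
  have hyι (t : G) (a : A) : D' (ι t a) = M.right (ι t a) y - M.left (ι t a) y := by
    rw [hD0, hy, map_sub, ← M.right_mul, hul, ← M.left_right, ← hyc, ← M.left_mul, hul]
  refine ⟨z + y, fun b => ?_⟩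
  obtain ⟨f, rfl⟩ := hspan b
  simp only [map_sum, sum_apply, ← Finset.sum_sub_distrib]
  refine Finset.sum_congr rfl fun t _ => ?_
  have h3 : D (ι t (f t)) = D' (ι t (f t)) + (M.right (ι t (f t)) z - M.left (ι t (f t)) z) := by
    simp [D']
  rw [h3, hyι, map_add, map_add]; abel

end Contractible

/-! ### Second duals -/

section Bidual

variable {A B C : Type*} [NonUnitalNormedRing A] [NormedSpace ℂ A]
  [NonUnitalNormedRing B] [NormedSpace ℂ B] [NonUnitalNormedRing C] [NormedSpace ℂ C]

/-- The second adjoint `T** : A** → B**` of a bounded operator `T : A → B`. -/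
def bidualMap (T : A →L[ℂ] B) : SecondDual A →L[ℂ] SecondDual B :=
  let R : (B →L[ℂ] ℂ) →L[ℂ] (A →L[ℂ] ℂ) := (ContinuousLinearMap.compL ℂ A B ℂ).flip T
  (ContinuousLinearMap.compL ℂ (B →L[ℂ] ℂ) (A →L[ℂ] ℂ) ℂ).flip R

theorem SecondDual.ext {m n : SecondDual A}
    (h : ∀ f : StrongDual ℂ A, (show StrongDual ℂ (StrongDual ℂ A) from m) f
      = (show StrongDual ℂ (StrongDual ℂ A) from n) f) : m = n :=
  ContinuousLinearMap.ext h

variable [IsScalarTower ℂ A A] [SMulCommClass ℂ A A] [IsScalarTower ℂ B B] [SMulCommClass ℂ B B]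

/-- The Arens product is obtained from the product by repeated dualization, so the identity reduces
to one between functionals of `a` and `b`. Three different operators are allowed because the copies
of `A` at `s` and `t` multiply into the copy at `s * t`. -/
theorem bidualMap_mul (T S R : A →L[ℂ] B)
    (h : ∀ a b, T a * S b = R (a * b)) (m n : SecondDual A) :
    bidualMap T m * bidualMap S n = bidualMap R (m * n) := by
  refine SecondDual.ext fun f => ?_
  refine congrArg (show StrongDual ℂ (StrongDual ℂ A) from m) (ContinuousLinearMap.ext fun a => ?_)
  refine congrArg (show StrongDual ℂ (StrongDual ℂ A) from n) (ContinuousLinearMap.ext fun b => ?_)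
  exact congrArg f (h a b)

end Bidual

/-- A bounded net in a normed space has a weak-star cluster point in the second dual. -/
theorem exists_bidual_limit {X : Type*} [NormedAddCommGroup X] [NormedSpace ℂ X]
    {I : Type*} (F : Filter I) [F.NeBot] (b : I → X) {C : ℝ} (hb : ∀ n, ‖b n‖ ≤ C) : ∃ m : StrongDual ℂ (StrongDual ℂ X),
      ∀ (f : StrongDual ℂ X) (l : ℂ), Filter.Tendsto (fun n => f (b n)) F (nhds l) →
        m f = l := by
  let J : X →L[ℂ] StrongDual ℂ (StrongDual ℂ X) := NormedSpace.inclusionInDoubleDual ℂ X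
  let K := (WeakDual.toStrongDual : WeakDual ℂ (StrongDual ℂ X) ≃ₗ[ℂ] _) ⁻¹' Metric.closedBall 0 C
  have hK : IsCompact K := WeakDual.isCompact_closedBall (𝕜 := ℂ) 0 C
  let x : I → WeakDual ℂ (StrongDual ℂ X) := fun n => StrongDual.toWeakDual (J (b n))
  have hx (n : I) : x n ∈ K := by
    refine (mem_closedBall_zero_iff (E := StrongDual ℂ (StrongDual ℂ X))).2 ?_
    exact (NormedSpace.double_dual_bound ℂ X (b n)).trans (hb n)
  -- Banach–Alaoglu along an ultrafilter finer than `F`: one `m` serves all functionals at once.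
  obtain ⟨m, -, hm⟩ := hK.ultrafilter_le_nhds ((Ultrafilter.of F).map x)
    (Filter.le_principal_iff.2 (Filter.univ_mem' (f := Ultrafilter.of F) hx))
  refine ⟨WeakDual.toStrongDual m, fun f l hl => ?_⟩
  have h1 : Filter.Tendsto (fun n => f (b n)) (Ultrafilter.of F) (nhds (m f)) :=
    ((WeakDual.eval_continuous f).tendsto m).comp hm
  exact tendsto_nhds_unique h1 (hl.mono_left (Ultrafilter.of_le F))

/-! ### Alternating sets in noncompact groups -/

section Groups

open scoped Pointwise

variable {G : Type*} [Group G] [TopologicalSpace G] [IsTopologicalGroup G]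

/-- In a noncompact group a relatively compact symmetric open neighbourhood of `1` can be
enlarged so as to contain all products, and a point far away. -/
theorem exists_enlargement [NoncompactSpace G] [T2Space G] (K : Set G)
    (hK : (1 : G) ∈ K ∧ IsOpen K ∧ K⁻¹ = K ∧ ∃ C, IsCompact C ∧ K ⊆ C) :
    ∃ (K' : Set G) (t : G), ((1 : G) ∈ K' ∧ IsOpen K' ∧ K'⁻¹ = K' ∧ ∃ C, IsCompact C ∧ K' ⊆ C) ∧
      K * K ⊆ K' ∧ t ∈ K' ∧ t ∉ K * K * K * K * K := by
  obtain ⟨h1, ho, hi, C, hC, hKC⟩ := hK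
  obtain ⟨t, ht⟩ : ∃ t, t ∉ K * K * K * K * K := by
    by_contra! h
    have hC5 : IsCompact (C * C * C * C * C) := (((hC.mul hC).mul hC).mul hC).mul hC
    refine noncompact_univ G ?_
    convert hC5
    refine (Set.eq_univ_of_forall fun x => ?_).symm
    exact Set.mul_subset_mul (Set.mul_subset_mul (Set.mul_subset_mul
      (Set.mul_subset_mul hKC hKC) hKC) hKC) hKC (h x)
  -- A symmetric set containing `K` and `t`; its square is the required enlargement.
  let L : Set G := K ∪ {t} * K ∪ K * {t⁻¹}
  have hL1 : (1 : G) ∈ L := Or.inl (Or.inl h1)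
  have hKL : K ⊆ L := fun x hx => Or.inl (Or.inl hx)
  have htL : t ∈ L := Or.inl (Or.inr ⟨t, rfl, 1, h1, mul_one t⟩)
  have hLo : IsOpen L := (ho.union ho.mul_left).union ho.mul_right
  have hLi : L⁻¹ = L := by
    simp only [L, Set.union_inv, mul_inv_rev, hi, Set.inv_singleton, inv_inv]
    rw [Set.union_assoc, Set.union_assoc, Set.union_comm (K * _)]
  have hLC : L ⊆ C ∪ {t} * C ∪ C * {t⁻¹} :=
    Set.union_subset_union (Set.union_subset_union hKC (Set.mul_subset_mul_left hKC))
      (Set.mul_subset_mul_right hKC)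
  have hLCc : IsCompact (C ∪ {t} * C ∪ C * {t⁻¹}) :=
    (hC.union (isCompact_singleton.mul hC)).union (hC.mul isCompact_singleton)
  refine ⟨L * L, t, ⟨⟨1, hL1, 1, hL1, mul_one 1⟩, hLo.mul_left, ?_, _, hLCc.mul hLCc,
    Set.mul_subset_mul hLC hLC⟩, Set.mul_subset_mul hKL hKL, ⟨t, htL, 1, hL1, mul_one t⟩, ht⟩
  rw [mul_inv_rev, hLi]

/-- A noncompact locally compact group contains an open set `S` such that both `S` and its
complement contain, asymptotically, right translates of all finite sets, thickened by a fixed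
neighbourhood of `1`. -/
theorem exists_isOpen_alternating [NoncompactSpace G] [LocallyCompactSpace G] [T2Space G] :
    ∃ (S V : Set G) (t r : ℕ → G), IsOpen S ∧ IsOpen V ∧ (1 : G) ∈ V ∧
      (∃ C, IsCompact C ∧ V ⊆ C) ∧
      (∀ s, ∀ᶠ n in Filter.atTop, ∀ v ∈ V, s * t n * v ∈ S) ∧
      (∀ s, ∀ᶠ n in Filter.atTop, ∀ v ∈ V, s * r n * v ∈ Sᶜ) := by
  let P : Set G → Prop := fun K => (1 : G) ∈ K ∧ IsOpen K ∧ K⁻¹ = K ∧ ∃ C, IsCompact C ∧ K ⊆ C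
  obtain ⟨V, hV⟩ : ∃ V, P V := by
    obtain ⟨C, hC, hC1⟩ := exists_compact_mem_nhds (1 : G)
    refine ⟨interior C ∩ (interior C)⁻¹, ⟨mem_interior_iff_mem_nhds.2 hC1, ?_⟩,
      isOpen_interior.inter isOpen_interior.inv, ?_, C, hC,
      Set.inter_subset_left.trans interior_subset⟩
    · simpa using mem_interior_iff_mem_nhds.2 hC1
    · rw [Set.inter_inv, inv_inv, Set.inter_comm]
  choose! next pt hnext hmul hpt hfar using fun (K : Set G) (hK : P K) => exists_enlargement K hK
  let K : ℕ → Set G := fun n => n.rec V fun _ L => next L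
  have hP (n : ℕ) : P (K n) := by
    induction n with
    | zero => exact hV
    | succ n ih => exact hnext _ ih
  let x : ℕ → G := fun n => pt (K n)
  have hKK (n : ℕ) : K n * K n ⊆ K (n + 1) := hmul _ (hP n)
  have hmono : Monotone K := monotone_nat_of_le_succ fun n y hy =>
    hKK n ⟨y, hy, 1, (hP n).1, mul_one y⟩
  have hinv {n : ℕ} {y : G} (hy : y ∈ K n) : y⁻¹ ∈ K n := by
    rw [← (hP n).2.2.1]; simpa using hy
  have hx (n : ℕ) : x n ∈ K (n + 1) := hpt _ (hP n)
  have hxfar (n : ℕ) : x n ∉ K n * K n * K n * K n * K n := hfar _ (hP n)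
  -- The sets `K n * x n * V` and `K m * x m * V` are disjoint: a common point would write `x n` as
  -- a product of five elements of `K n`.
  have hdisj {m n : ℕ} (hmn : m < n) {k k' v v' : G} (hk : k ∈ K n) (hk' : k' ∈ K m)
      (hv : v ∈ V) (hv' : v' ∈ V) : k * x n * v ≠ k' * x m * v' := by
    intro h
    refine hxfar n ?_
    have h2 : x n = k⁻¹ * k' * x m * v' * v⁻¹ := by
      rw [mul_assoc k⁻¹, mul_assoc k⁻¹, ← h]; group
    rw [h2]
    have h0 : V ⊆ K n := hmono (Nat.zero_le n)
    exact Set.mul_mem_mul (Set.mul_mem_mul (Set.mul_mem_mul (Set.mul_mem_mul (hinv hk)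
      (hmono hmn.le hk')) (hmono hmn (hx m))) (h0 hv')) (hinv (h0 hv))
  have hdisj' {m n : ℕ} (hmn : m ≠ n) {k k' v v' : G} (hk : k ∈ K n) (hk' : k' ∈ K m)
      (hv : v ∈ V) (hv' : v' ∈ V) : k * x n * v ≠ k' * x m * v' := by
    rcases hmn.lt_or_gt with h | h
    · exact hdisj h hk hk' hv hv'
    · exact (hdisj h hk' hk hv' hv).symm
  let H : Subgroup G :=
    { carrier := ⋃ n, K n
      mul_mem' := by
        intro a b ha hb
        obtain ⟨m, hm⟩ := Set.mem_iUnion.1 ha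
        obtain ⟨n, hn⟩ := Set.mem_iUnion.1 hb
        exact Set.mem_iUnion.2 ⟨max m n + 1, hKK (max m n) (Set.mul_mem_mul
          (hmono (le_max_left m n) hm) (hmono (le_max_right m n) hn))⟩
      one_mem' := Set.mem_iUnion.2 ⟨0, hV.1⟩
      inv_mem' := by
        intro a ha
        obtain ⟨m, hm⟩ := Set.mem_iUnion.1 ha
        exact Set.mem_iUnion.2 ⟨m, hinv hm⟩ }
  have hKH {n : ℕ} {y : G} (hy : y ∈ K n) : y ∈ H := Set.mem_iUnion.2 ⟨n, hy⟩
  -- Even indices go into the set, odd ones stay outside it. Since `H` may be a proper subgroup, `S`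
  -- copies this pattern into every left coset.
  let S₀ : Set G := ⋃ n, K (2 * n) * {x (2 * n)} * V
  have hS₀ : IsOpen S₀ := isOpen_iUnion fun n => hV.2.1.mul_left
  have hS₀H {y : G} (hy : y ∈ S₀) : y ∈ H := by
    obtain ⟨n, _, ⟨k, hk, _, rfl, rfl⟩, v, hv, rfl⟩ := Set.mem_iUnion.1 hy
    exact H.mul_mem (H.mul_mem (hKH hk) (hKH (n := 2 * n + 1) (hx _))) (hKH (n := 0) hv)
  let S : Set G := ⋃ q : G ⧸ H, q.out • S₀
  have hdec (s : G) : ∃ (q : G ⧸ H) (N : ℕ) (h : G), h ∈ K N ∧ s = q.out * h := by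
    have : (s : G ⧸ H).out⁻¹ * s ∈ H := QuotientGroup.eq.1 (by simp)
    obtain ⟨N, hN⟩ := Set.mem_iUnion.1 (show _ ∈ ⋃ n, K n from this)
    exact ⟨s, N, _, hN, by simp⟩
  refine ⟨S, V, fun n => x (2 * n), fun n => x (2 * n + 1),
    isOpen_iUnion fun q => hS₀.smul _, hV.2.1, hV.1, hV.2.2.2, fun s => ?_, fun s => ?_⟩
  · obtain ⟨q, N, h, hh, rfl⟩ := hdec s
    filter_upwards [Filter.eventually_ge_atTop N] with n hn v hv
    refine Set.mem_iUnion.2 ⟨q, h * x (2 * n) * v, Set.mem_iUnion.2 ⟨n, ?_⟩, ?_⟩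
    · exact Set.mul_mem_mul (Set.mul_mem_mul (hmono (by omega) hh) rfl) hv
    · simp only [smul_eq_mul, mul_assoc]
  · obtain ⟨q, N, h, hh, rfl⟩ := hdec s
    filter_upwards [Filter.eventually_ge_atTop N] with n hn v hv hmem
    obtain ⟨q', y, hy, hyq⟩ := Set.mem_iUnion.1 hmem
    replace hyq : q'.out * y = q.out * (h * x (2 * n + 1) * v) := by
      simpa only [smul_eq_mul, mul_assoc] using hyq
    have hz : h * x (2 * n + 1) * v ∈ H :=
      H.mul_mem (H.mul_mem (hKH hh) (hKH (n := 2 * n + 1 + 1) (hx (2 * n + 1)))) (hKH (n := 0) hv)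
    have hqq : q' = q := by
      rw [← Quotient.out_eq' q', ← Quotient.out_eq' q]
      have h3 : (q'.out : G ⧸ H) = ((q'.out * y : G) : G ⧸ H) :=
        (QuotientGroup.mk_mul_of_mem _ (hS₀H hy)).symm
      have h4 : (q.out : G ⧸ H) = ((q.out * (h * x (2 * n + 1) * v) : G) : G ⧸ H) :=
        (QuotientGroup.mk_mul_of_mem _ hz).symm
      rw [hyq] at h3
      exact h3.trans h4.symm
    subst hqq
    have hyz := mul_left_cancel hyq
    obtain ⟨m, _, ⟨k, hk, _, rfl, rfl⟩, v', hv', rfl⟩ := Set.mem_iUnion.1 hy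
    exact hdisj' (m := 2 * n + 1) (n := 2 * m) (by omega) hk
      (hmono (by omega : N ≤ 2 * n + 1) hh) hv' hv hyz

end Groups

/-! ### Integration functionals, and compactness of `G` -/

section L1

variable {G : Type*} [Group G] [TopologicalSpace G] [IsTopologicalGroup G]
  [LocallyCompactSpace G] [MeasurableSpace G] [BorelSpace G]
  {μ : Measure G} [μ.IsHaarMeasure] [μ.Regular]
  {A : Type*} [NonUnitalNormedRing A] [NormedSpace ℂ A] [IsScalarTower ℂ A A]
  [SMulCommClass ℂ A A] [CompleteSpace A]

theorem leftTranslate_one (f : Lp A 1 μ) : leftTranslate 1 f = f := by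
  simp [leftTranslate]

variable (μ A) in
/-- Integration over `s` as a bounded operator on `L¹(G, A)`. -/
def setIntegralL (s : Set G) : L1Alg μ A →L[ℂ] A :=
  ((L1.integralCLM' ℂ).comp (LpToLpRestrictCLM G A ℂ μ 1 s) : Lp A 1 μ →L[ℂ] A)

theorem setIntegralL_apply (s : Set G) (f : Lp A 1 μ) :
    setIntegralL μ A s f = ∫ x in s, f x ∂μ := by
  have h1 : setIntegralL μ A s f = ∫ x in s, LpToLpRestrictCLM G A ℂ μ 1 s f x ∂μ := by
    rw [← L1.integral_eq_integral, L1.integral_eq' ℂ]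
    rfl
  rw [h1]
  exact integral_congr_ae (LpToLpRestrictCLM_coeFn ℂ s f)

theorem setIntegralL_univ (f : Lp A 1 μ) : setIntegralL μ A Set.univ f = ∫ x, f x ∂μ := by
  rw [setIntegralL_apply, setIntegral_univ]

theorem setIntegralL_add_compl {s : Set G} (hs : MeasurableSet s) :
    setIntegralL μ A s + setIntegralL μ A sᶜ = setIntegralL μ A Set.univ := by
  refine ContinuousLinearMap.ext fun f => ?_
  let f' : Lp A 1 μ := f
  show setIntegralL μ A s f' + setIntegralL μ A sᶜ f' = setIntegralL μ A Set.univ f'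
  rw [setIntegralL_apply, setIntegralL_apply, setIntegralL_univ]
  exact integral_add_compl hs (L1.integrable_coeFn f')

theorem setIntegralL_leftMulL1 (s : Set G) (a : A) (f : Lp A 1 μ) :
    setIntegralL μ A s (leftMulL1 a f) = a * setIntegralL μ A s f := by
  rw [setIntegralL_apply, setIntegralL_apply]
  refine Eq.trans (integral_congr_ae (ae_restrict_of_ae (leftMulL1_ae a f)))
    ((ContinuousLinearMap.mul ℂ A a).integral_comp_comm (L1.integrable_coeFn f).restrict)

theorem map_convL1 {E : Type*} [NormedAddCommGroup E] [NormedSpace ℂ E] [CompleteSpace E]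
    (F : L1Alg μ A →L[ℂ] E) (f g : Lp A 1 μ) :
    F (convL1 f g) = ∫ t, F (leftMulL1 (f t) (leftTranslate t g)) ∂μ :=
  ((show Lp A 1 μ →L[ℂ] E from F).integral_comp_comm (integrable_convL1 f g)).symm

theorem setIntegralL_univ_leftTranslate (t : G) (f : Lp A 1 μ) :
    setIntegralL μ A Set.univ (leftTranslate t f) = setIntegralL μ A Set.univ f := by
  rw [setIntegralL_univ, setIntegralL_univ, integral_congr_ae (leftTranslate_ae t f)]
  exact integral_mul_left_eq_self (fun x => f x) t⁻¹

/-- Left invariance makes the total integral of the translated factor independent of `t`, so it can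
be pulled out of the convolution integral. -/
theorem setIntegralL_univ_mul (f g : L1Alg μ A) :
    setIntegralL μ A Set.univ (f * g) =
      setIntegralL μ A Set.univ f * setIntegralL μ A Set.univ g := by
  let f' : Lp A 1 μ := f
  let g' : Lp A 1 μ := g
  show setIntegralL μ A Set.univ (convL1 f' g') =
    setIntegralL μ A Set.univ f' * setIntegralL μ A Set.univ g'
  rw [map_convL1, setIntegralL_univ f']
  simp only [setIntegralL_leftMulL1, setIntegralL_univ_leftTranslate]
  exact ((ContinuousLinearMap.mul ℂ A).flip (setIntegralL μ A Set.univ g')).integral_comp_comm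
    (L1.integrable_coeFn f')

theorem setIntegralL_leftTranslate_indicator {s V : Set G}
    (hV : MeasurableSet V) (hμV : μ V ≠ ∞) (a : A) (t : G) :
    setIntegralL μ A s (leftTranslate t (indicatorConstLp 1 hV hμV a)) =
      μ.real (s ∩ (fun x => t⁻¹ * x) ⁻¹' V) • a := by
  have hV' : MeasurableSet ((fun x => t⁻¹ * x) ⁻¹' V) := (measurable_const_mul t⁻¹) hV
  have h1 : (fun x => (indicatorConstLp 1 hV hμV a : Lp A 1 μ) (t⁻¹ * x)) =ᵐ[μ]
      ((fun x => t⁻¹ * x) ⁻¹' V).indicator fun _ => a :=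
    (measurePreserving_mul_left μ t⁻¹).quasiMeasurePreserving.ae_eq_comp
      (indicatorConstLp_coeFn (p := 1) (hs := hV) (hμs := hμV) (c := a))
  rw [setIntegralL_apply, integral_congr_ae (ae_restrict_of_ae (leftTranslate_ae t _)),
    integral_congr_ae (ae_restrict_of_ae h1), setIntegral_indicator hV', setIntegral_const]

/-- An invariant functional `w` on `L¹(G, A)*` takes the value `1` at the functional integrating
over a set that contains, asymptotically, right translates of all finite sets. -/
theorem absorbing_setIntegralL_eq_one {w : StrongDual ℂ (StrongDual ℂ (L1Alg μ A))}
    {φ : A →L[ℂ] ℂ} (hφ : ∀ a b, φ (a * b) = φ a * φ b) (hne : φ ≠ 0)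
    (hw1 : w (φ.comp (setIntegralL μ A Set.univ)) = 1)
    (hw : ∀ m f, w (bidualAct m f) = m (φ.comp (setIntegralL μ A Set.univ)) * w f)
    {U V : Set G} (hV : MeasurableSet V) (hV0 : μ V ≠ 0) (hμV : μ V ≠ ∞)
    (t : ℕ → G) (ht : ∀ s, ∀ᶠ n in Filter.atTop, ∀ v ∈ V, s * t n * v ∈ U) :
    w (φ.comp (setIntegralL μ A U)) = 1 := by
  obtain ⟨a, ha⟩ := exists_map_eq_one hne
  let Φ := φ.comp (setIntegralL μ A Set.univ)
  let b : Lp A 1 μ := indicatorConstLp 1 hV hμV a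
  let c : ℂ := (μ.real V : ℝ)
  have hc : c ≠ 0 := by
    simp only [c, ne_eq, Complex.ofReal_eq_zero]
    exact (ENNReal.toReal_pos hV0 hμV).ne'
  have hval (s : G) {T : Set G} (h : ∀ v ∈ V, s * v ∈ T) :
      φ (setIntegralL μ A T (leftTranslate s b)) = c := by
    rw [setIntegralL_leftTranslate_indicator hV hμV]
    have : T ∩ (fun x => s⁻¹ * x) ⁻¹' V = (fun x => s⁻¹ * x) ⁻¹' V := by
      refine Set.inter_eq_right.2 fun x hx => ?_
      simpa using h _ hx
    rw [this, measureReal_def, measure_preimage_mul]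
    rw [← Complex.coe_smul, map_smul, ha, smul_eq_mul, mul_one]
    rfl
  obtain ⟨m, hm⟩ := exists_bidual_limit (X := L1Alg μ A) Filter.atTop
    (fun n => leftTranslate (t n) b) (C := ‖b‖) (fun n => (norm_leftTranslate (t n) b).le)
  have hmΦ : m Φ = c := hm Φ c (by
    have (n : ℕ) : Φ (leftTranslate (t n) b) = c := hval _ (fun _ _ => trivial)
    simp only [this]
    exact tendsto_const_nhds)
  -- For each `s`, the translate of `V` by `s * t n` eventually lies in `U`, so integrating over `U`
  -- eventually agrees with integrating over `G`. Dominated convergence carries this to `f'` and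
  -- needs a sequence of translates.
  have hmf : bidualAct m (φ.comp (setIntegralL μ A U)) = c • Φ := by
    refine ContinuousLinearMap.ext fun f => ?_
    let f' : Lp A 1 μ := f
    rw [bidualAct_apply]
    refine hm _ _ ?_
    let F := φ.comp (setIntegralL μ A U)
    let F' : Lp A 1 μ →L[ℂ] ℂ := F
    have h1 (n : ℕ) : dualAct F f (leftTranslate (t n) b) =
        ∫ s, F (leftMulL1 (f' s) (leftTranslate s (leftTranslate (t n) b))) ∂μ :=
      map_convL1 F f' (leftTranslate (t n) b)
    have h2 (n : ℕ) (s : G) :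
        F (leftMulL1 (f' s) (leftTranslate s (leftTranslate (t n) b))) =
        φ (f' s) * φ (setIntegralL μ A U (leftTranslate (s * t n) b)) := by
      show φ (setIntegralL μ A U _) = _
      rw [setIntegralL_leftMulL1, hφ, leftTranslate_mul]
    have h3 : (c • Φ) f = ∫ s, φ (f' s) * c ∂μ := by
      rw [integral_mul_const, φ.integral_comp_comm (L1.integrable_coeFn f'),
        ← setIntegralL_univ]
      exact mul_comm _ _
    rw [h3]
    refine Filter.Tendsto.congr (fun n => (h1 n).symm) ?_
    refine tendsto_integral_of_dominated_convergence
      (fun s => ‖F'‖ * (‖f' s‖ * ‖b‖)) (F := fun n s => F (leftMulL1 (f' s) (leftTranslate s (leftTranslate (t n) b))))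
      (fun n => ?_) ?_ (fun n => ?_) ?_
    · exact (F'.integrable_comp (integrable_convL1 f' (leftTranslate (t n) b))).aestronglyMeasurable
    · exact ((L1.integrable_coeFn f').norm.mul_const _).const_mul _
    · refine Filter.Eventually.of_forall fun s => ?_
      refine (F'.le_opNorm _).trans ?_
      refine mul_le_mul_of_nonneg_left ((norm_leftMulL1_le _ _).trans_eq ?_) (norm_nonneg _)
      rw [norm_leftTranslate, norm_leftTranslate]
    · refine Filter.Eventually.of_forall fun s => ?_
      refine Filter.Tendsto.congr' ?_ tendsto_const_nhds
      filter_upwards [ht s] with n hn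
      rw [h2, hval _ hn]
  have h5 := hw m (φ.comp (setIntegralL μ A U))
  rw [hmf, map_smul, show m (φ.comp (setIntegralL μ A Set.univ)) = c from hmΦ, smul_eq_mul] at h5
  exact (mul_left_cancel₀ hc h5).symm.trans hw1

/-- If `L¹(G, A)**` has a right absorbing element for a character coming from `A`, then `G` is
compact. -/
theorem compactSpace_of_absorbing [T2Space G] {w : StrongDual ℂ (StrongDual ℂ (L1Alg μ A))}
    {φ : A →L[ℂ] ℂ} (hφ : ∀ a b, φ (a * b) = φ a * φ b) (hne : φ ≠ 0)
    (hw1 : w (φ.comp (setIntegralL μ A Set.univ)) = 1)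
    (hw : ∀ m f, w (bidualAct m f) = m (φ.comp (setIntegralL μ A Set.univ)) * w f) :
    CompactSpace G := by
  by_contra hG
  have : NoncompactSpace G := not_compactSpace_iff.1 hG
  obtain ⟨S, V, t, r, hS, hV, h1V, ⟨C, hC, hVC⟩, ht, hr⟩ := exists_isOpen_alternating (G := G)
  have hV0 : μ V ≠ 0 := (hV.measure_pos μ ⟨1, h1V⟩).ne'
  have hμV : μ V ≠ ∞ := ((measure_mono hVC).trans_lt hC.measure_lt_top).ne
  have h1 := absorbing_setIntegralL_eq_one hφ hne hw1 hw hV.measurableSet hV0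
    hμV t ht
  have h2 := absorbing_setIntegralL_eq_one hφ hne hw1 hw hV.measurableSet
    hV0 hμV r hr
  rw [← setIntegralL_add_compl hS.measurableSet, ContinuousLinearMap.comp_add, map_add, h1, h2]
    at hw1
  norm_num at hw1

end L1

/-! ### Compact groups: discreteness from a left identity -/

section CompactGroups

open scoped Pointwise

variable {G : Type*} [Group G] [TopologicalSpace G] [IsTopologicalGroup G] [CompactSpace G]
  [MeasurableSpace G] [BorelSpace G] (μ : Measure G) [μ.IsHaarMeasure] [μ.Regular]

/-- A compact group is unimodular. -/
theorem isMulRightInvariant_of_compactSpace : μ.IsMulRightInvariant := by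
  refine ⟨fun g => ?_⟩
  -- The pushforward is again left invariant, hence a multiple of `μ`; comparing finite total masses
  -- gives the factor `1`.
  have h := Measure.isMulInvariant_eq_smul_of_compactSpace (μ.map (· * g)) μ
  have h1 := congrArg (fun ν : Measure G => ν Set.univ) h
  have hu : μ Set.univ ≠ 0 := (isOpen_univ.measure_pos μ Set.univ_nonempty).ne'
  simp only [Measure.map_apply (measurable_mul_const g) MeasurableSet.univ, Set.preimage_univ,
    Measure.smul_apply] at h1
  have h2 : Measure.haarScalarFactor (μ.map (· * g)) μ = 1 := by
    have h3 : (1 : ℝ≥0∞) * μ Set.univ =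
        (Measure.haarScalarFactor (μ.map (· * g)) μ : ℝ≥0∞) * μ Set.univ := by
      rw [one_mul]; exact h1
    exact_mod_cast ((ENNReal.mul_left_inj hu (measure_ne_top μ _)).1 h3).symm
  rw [h, h2, one_smul]

variable [T2Space G]

/-- A compact group without isolated points has dense open sets that are not of full measure. -/
theorem exists_dense_isOpen_measure_lt [(nhdsWithin (1 : G) {1}ᶜ).NeBot] :
    ∃ U : Set G, IsOpen U ∧ Dense U ∧ μ U < μ Set.univ := by
  have := isMulRightInvariant_of_compactSpace μ
  have hu : μ Set.univ ≠ 0 := (isOpen_univ.measure_pos μ Set.univ_nonempty).ne'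
  obtain ⟨ε, hε0, hε⟩ := ENNReal.exists_pos_sum_of_countable hu ℕ
  let P : Set G → Prop := fun V => (1 : G) ∈ V ∧ IsOpen V ∧ V⁻¹ = V
  have hcover (V : Set G) (hV : P V) : ∃ F : Finset G, ∀ x, ∃ f ∈ F, x * f⁻¹ ∈ V := by
    obtain ⟨F, hF⟩ := compact_covered_by_mul_left_translates (isCompact_univ (X := G))
      (V := V) ⟨1, by rw [hV.2.1.interior_eq]; exact hV.1⟩
    refine ⟨F, fun x => ?_⟩
    obtain ⟨f, hf, hx⟩ := Set.mem_iUnion₂.1 (hF (Set.mem_univ x⁻¹))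
    refine ⟨f, hf, ?_⟩
    rw [← hV.2.2]
    simpa using hx
  choose! F hF using hcover
  -- Singletons are null because `1` is not isolated. The new neighbourhood is small relative to the
  -- number of translates of the old one needed to cover `G`.
  have hstep (n : ℕ) (V : Set G) (hV : P V) : ∃ V', P V' ∧ V' * V' ⊆ V ∧
      (F V).card * μ V' ≤ ε n := by
    have hpos : (0 : ℝ≥0∞) < ε n / ((F V).card + 1) :=
      ENNReal.div_pos (by simpa using (hε0 n).ne') (by finiteness)
    obtain ⟨W, hW1, hWo, hWμ⟩ := Set.exists_isOpen_lt_of_lt ({1} : Set G) _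
      (show μ {1} < _ by rw [measure_singleton]; exact hpos)
    obtain ⟨O, hO, h1O, hOO⟩ := exists_open_nhds_one_mul_subset
      ((hWo.inter hV.2.1).mem_nhds ⟨hW1 rfl, hV.1⟩)
    have hOW : O ⊆ W := fun x hx => (hOO ⟨x, hx, 1, h1O, mul_one x⟩).1
    refine ⟨O ∩ O⁻¹, ⟨⟨h1O, by simpa using h1O⟩, hO.inter hO.inv, ?_⟩, ?_, ?_⟩
    · rw [Set.inter_inv, inv_inv, Set.inter_comm]
    · exact (Set.mul_subset_mul Set.inter_subset_left Set.inter_subset_left).trans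
        (hOO.trans Set.inter_subset_right)
    · calc ((F V).card : ℝ≥0∞) * μ (O ∩ O⁻¹)
          ≤ ((F V).card + 1) * (ε n / ((F V).card + 1)) := by
            gcongr
            · exact le_self_add
            · exact (measure_mono (Set.inter_subset_left.trans hOW)).trans hWμ.le
        _ = ε n := ENNReal.mul_div_cancel (by simp) (by finiteness)
  choose! next hnext hmul hsmall using hstep
  let V : ℕ → Set G := fun n => n.rec Set.univ next
  have hP (n : ℕ) : P (V n) := by
    induction n with
    | zero => exact ⟨Set.mem_univ _, isOpen_univ, Set.inv_univ⟩
    | succ n ih => exact hnext n _ ih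
  have hVV (n : ℕ) : V (n + 1) * V (n + 1) ⊆ V n := hmul n _ (hP n)
  have hanti : Antitone V := antitone_nat_of_succ_le fun n x hx =>
    hVV n ⟨x, hx, 1, (hP (n + 1)).1, mul_one x⟩
  have hinv {n : ℕ} {y : G} (hy : y ∈ V n) : y⁻¹ ∈ V n := by
    rw [← (hP n).2.2]; simpa using hy
  have hcl (n : ℕ) : closure (V (n + 1)) ⊆ V n := by
    intro x hx
    obtain ⟨_, ⟨v, hv, rfl⟩, hv'⟩ := mem_closure_iff.1 hx (x • V (n + 1)) ((hP (n + 1)).2.1.smul x)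
      ⟨1, (hP (n + 1)).1, mul_one x⟩
    exact hVV n ⟨_, hv', v⁻¹, hinv (n := n + 1) hv, by simp⟩
  let N : Set G := ⋂ n, V n
  have hNinv {y : G} (hy : y ∈ N) : y⁻¹ ∈ N :=
    Set.mem_iInter.2 fun n => hinv (Set.mem_iInter.1 hy n)
  -- The finite nets `F (V n)` together form a countable set that is dense modulo `N`, so `U`, which
  -- contains all cosets `N * {f}`, is dense. Since `N * V (n + 2) ⊆ V (n + 1)`, its measure is at
  -- most the sum of the `ε n`. Passing through `N` avoids any countability assumption on `G`.
  let U : Set G := ⋃ n, ⋃ f ∈ F (V n), N * V (n + 2) * {f}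
  refine ⟨U, isOpen_iUnion fun n => isOpen_biUnion fun f _ =>
    ((hP (n + 2)).2.1.mul_left).mul_right, ?_, ?_⟩
  · rw [dense_iff_inter_open]
    rintro O hO ⟨x, hx⟩
    let W : Set G := (fun w => w * x) ⁻¹' O
    have hW : IsOpen W := hO.preimage (continuous_mul_const x)
    have hW1 : (1 : G) ∈ W := by simpa [W] using hx
    -- The closures of the `V k` decrease to `N`, and the complement of the open set `N * W` is
    -- compact.
    obtain ⟨k, hk⟩ : ∃ k, V k ⊆ N * W := by
      have hNW : IsCompact (N * W)ᶜ := hW.mul_left.isClosed_compl.isCompact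
      obtain ⟨k, hk⟩ := hNW.elim_directed_cover (fun k => (closure (V k))ᶜ)
        (fun k => isClosed_closure.isOpen_compl) (fun y hy => by
          by_contra h
          refine hy ⟨y, Set.mem_iInter.2 fun n => hcl n ?_, 1, hW1, mul_one y⟩
          by_contra h'
          exact h (Set.mem_iUnion.2 ⟨n + 1, h'⟩))
        (Monotone.directed_le fun i j hij =>
          Set.compl_subset_compl.2 (closure_mono (hanti hij)))
      refine ⟨k, fun y hy => ?_⟩
      by_contra h
      exact hk h (subset_closure hy)
    obtain ⟨f, hf, hxf⟩ := hF _ (hP k) x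
    obtain ⟨n, hn, w, hw, hnw⟩ := hk (hinv hxf)
    refine ⟨w * x, hw, Set.mem_iUnion.2 ⟨k, Set.mem_iUnion₂.2 ⟨f, hf, ?_⟩⟩⟩
    refine ⟨n⁻¹, ⟨n⁻¹, hNinv hn, 1, (hP (k + 2)).1, mul_one _⟩, f, rfl, ?_⟩
    have h1 : n * w * x = f := by
      have : n * w = (x * f⁻¹)⁻¹ := hnw
      rw [this]; group
    show n⁻¹ * f = w * x
    rw [← h1]; group
  · refine lt_of_le_of_lt ?_ hε
    refine (measure_iUnion_le _).trans (ENNReal.tsum_le_tsum fun n => ?_)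
    refine (measure_biUnion_finset_le _ _).trans ?_
    refine (Finset.sum_le_card_nsmul _ _ (μ (V (n + 1))) fun f _ => ?_).trans ?_
    · have h1 : N * V (n + 2) * {f} ⊆ (fun x => x * f⁻¹) ⁻¹' V (n + 1) := by
        rintro _ ⟨_, ⟨y, hy, v, hv, rfl⟩, _, rfl, rfl⟩
        have : y * v ∈ V (n + 1) := hVV (n + 1) ⟨y, Set.mem_iInter.1 hy (n + 2), v, hv, rfl⟩
        simpa using this
      exact (measure_mono h1).trans_eq (measure_preimage_mul_right μ f⁻¹ _)
    · rw [nsmul_eq_mul]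
      exact hsmall n _ (hP n)

variable {A : Type*} [NonUnitalNormedRing A] [NormedSpace ℂ A] [IsScalarTower ℂ A A]
  [SMulCommClass ℂ A A] [CompleteSpace A]

variable {μ}

/-- Right translates of `f ∈ L¹(G, A)` by elements near `1` are close to `f`, and therefore so
are the convolutions of `f` with translates of `g`. -/
theorem tendsto_convL1_leftTranslate_sub (f : Lp A 1 μ) {C : ℝ} (g : G → Lp A 1 μ)
    (hg : ∀ t, ‖g t‖ ≤ C) :
    Filter.Tendsto (fun t => convL1 f (leftTranslate t (g t)) - convL1 f (g t)) (nhds 1)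
      (nhds 0) := by
  have := isMulRightInvariant_of_compactSpace μ
  let m : G → C(G, G) := fun t => ⟨fun s => s * t⁻¹, continuous_mul_const _⟩
  have hm : Continuous m := by
    refine (ContinuousMap.curry ⟨fun p : G × G => p.2 * p.1⁻¹, by fun_prop⟩).continuous
  have hmp (t : G) : MeasurePreserving (m t) μ μ := measurePreserving_mul_right μ t⁻¹
  -- By right invariance, translating the second factor of a convolution by `t` on the left amounts
  -- to replacing `f` by `s ↦ f (s * t⁻¹)`, which depends continuously on `t` in `L¹`.
  let R : G → Lp A 1 μ := fun t => Lp.compMeasurePreserving (m t) (hmp t) f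
  have hR : Continuous R := 
    Continuous.compMeasurePreservingLp (f := fun _ => f) (g := m) continuous_const hm hmp
      ENNReal.one_ne_top
  have hR1 : R 1 = f := by
    refine Lp.ext ((Lp.coeFn_compMeasurePreserving f (hmp 1)).trans ?_)
    refine Filter.Eventually.of_forall fun s => ?_
    simp [m]
  have hconv (t : G) (h : Lp A 1 μ) : convL1 f (leftTranslate t h) = convL1 (R t) h := by
    unfold convL1
    rw [← integral_mul_right_eq_self _ t⁻¹]
    refine integral_congr_ae ?_
    filter_upwards [Lp.coeFn_compMeasurePreserving f (hmp t)] with s hs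
    rw [← leftTranslate_mul, inv_mul_cancel_right, hs]
    rfl
  have hlim : Filter.Tendsto (fun t => ‖R t - f‖ * C) (nhds 1) (nhds 0) := by
    have := ((hR.sub (continuous_const (y := f))).norm.mul_const C).tendsto (1 : G)
    simpa [hR1] using this
  refine squeeze_zero_norm (fun t => ?_) hlim
  rw [hconv]
  have : convL1 (R t) (g t) - convL1 f (g t) = convL1 (R t - f) (g t) := by
    have := add_convL1 (R t - f) f (g t)
    rw [sub_add_cancel] at this
    rw [this, add_sub_cancel_right]
  rw [this]
  exact (norm_convL1_le _ _).trans (mul_le_mul_of_nonneg_left (hg t) (norm_nonneg _))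

/-- If `L¹(G, A)**` has a left identity, then small translations move every measurable set by a
null set. -/
theorem eventually_measure_diff_eq_zero {e : StrongDual ℂ (StrongDual ℂ (L1Alg μ A))}
    (he : ∀ m f, e (bidualAct m f) = m f) {φ : A →L[ℂ] ℂ} (hne : φ ≠ 0)
    {U : Set G} (hU : MeasurableSet U) :
    ∀ᶠ t in nhds (1 : G), μ {x | x ∈ U ∧ t * x ∉ U} = 0 := by
  obtain ⟨a, ha⟩ := exists_map_eq_one hne
  let D : G → Set G := fun t => {x | x ∈ U ∧ t * x ∉ U}
  have hD (t : G) : MeasurableSet (D t) := hU.inter ((measurable_const_mul t) hU.compl)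
  by_contra hcon
  let T : Set G := {t | μ (D t) ≠ 0}
  have hT : (nhdsWithin (1 : G) T).NeBot := by
    refine mem_closure_iff_nhdsWithin_neBot.1 (mem_closure_iff_frequently.2 ?_)
    exact Filter.not_eventually.1 hcon
  -- The bump sits on the part of `U` that `t` carries out of `U`, so integration over `U` sees `b
  -- t` but not its translate. Where `D t` is null the inverse is `0`, and the norm bound persists.
  let b : G → Lp A 1 μ := fun t =>
    indicatorConstLp 1 (hD t) (measure_ne_top μ _) (((μ.real (D t) : ℝ) : ℂ)⁻¹ • a)
  have hb (t : G) : ‖b t‖ ≤ ‖a‖ := by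
    refine norm_indicatorConstLp_le.trans ?_
    rw [norm_smul, norm_inv, Complex.norm_real, Real.norm_of_nonneg measureReal_nonneg]
    rw [ENNReal.toReal_one, div_one, Real.rpow_one]
    rcases eq_or_ne (μ.real (D t)) 0 with h | h
    · simp [h]
    · exact (by field_simp : _ = ‖a‖).le
  obtain ⟨m, hm⟩ := exists_bidual_limit (X := L1Alg μ A) (nhdsWithin (1 : G) T)
    (fun t => leftTranslate t (b t) - b t) (C := ‖a‖ + ‖a‖) (fun t =>
      (norm_sub_le (leftTranslate t (b t)) (b t)).trans
        (add_le_add ((norm_leftTranslate t (b t)).trans_le (hb t)) (hb t)))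
  -- Convolving on the left with a fixed element of `L¹` smooths out the difference, so this action
  -- vanishes although `m` does not.
  have hm0 (f : StrongDual ℂ (L1Alg μ A)) : bidualAct m f = 0 := by
    refine ContinuousLinearMap.ext fun c => ?_
    let c' : Lp A 1 μ := c
    let f' : Lp A 1 μ →L[ℂ] ℂ := f
    rw [bidualAct_apply]
    refine hm _ _ ?_
    have h1 := (f'.continuous.tendsto 0).comp
      ((tendsto_convL1_leftTranslate_sub c' b hb).mono_left
        (nhdsWithin_le_nhds (a := (1 : G)) (s := T)))
    rw [map_zero] at h1
    refine h1.congr fun t => ?_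
    show f' _ = f' (convL1 c' (leftTranslate t (b t) - b t))
    congr 1
    have := convL1_add c' (leftTranslate t (b t) - b t) (b t)
    rw [sub_add_cancel] at this
    exact sub_eq_of_eq_add this
  let g := φ.comp (setIntegralL μ A U)
  have hgm : m g = -1 := by
    refine hm g (-1) ?_
    refine Filter.Tendsto.congr' ?_ tendsto_const_nhds
    filter_upwards [self_mem_nhdsWithin] with t ht
    have h1 : setIntegralL μ A U (leftTranslate t (b t)) = 0 := by
      rw [setIntegralL_leftTranslate_indicator]
      have : U ∩ (fun x => t⁻¹ * x) ⁻¹' D t = ∅ := by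
        refine Set.eq_empty_of_forall_notMem fun x hx => hx.2.2 ?_
        simpa using hx.1
      rw [this]; simp
    have h2 : setIntegralL μ A U (b t) = a := by
      have h3 : b t = leftTranslate 1 (b t) := (leftTranslate_one _).symm
      rw [h3, setIntegralL_leftTranslate_indicator]
      have : U ∩ (fun x => (1 : G)⁻¹ * x) ⁻¹' D t = D t := by
        simp only [inv_one, one_mul]
        exact Set.inter_eq_right.2 fun x hx => hx.1
      have h4 : μ.real (D t) ≠ 0 := (ENNReal.toReal_pos ht (measure_ne_top μ _)).ne'
      rw [this, ← Complex.coe_smul, smul_smul, mul_inv_cancel₀ (by exact_mod_cast h4), one_smul]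
    have h5 : setIntegralL μ A U (leftTranslate t (b t) - b t) =
      setIntegralL μ A U (leftTranslate t (b t)) - setIntegralL μ A U (b t) := map_sub _ _ _
    show -1 = φ (setIntegralL μ A U (leftTranslate t (b t) - b t))
    rw [h5, h1, h2, zero_sub, map_neg, ha]
  have := he m g
  rw [hm0, map_zero, hgm] at this
  norm_num at this

/-- A compact group `G` such that `L¹(G, A)**` has a left identity is finite. -/
theorem finite_of_bidual_left_identity {e : StrongDual ℂ (StrongDual ℂ (L1Alg μ A))}
    (he : ∀ m f, e (bidualAct m f) = m f) {φ : A →L[ℂ] ℂ} (hne : φ ≠ 0) : Finite G := by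
  by_contra hG
  have hN : (nhdsWithin (1 : G) {1}ᶜ).NeBot := by
    by_contra h
    have h1 : IsOpen ({1} : Set G) := by
      rw [isOpen_singleton_iff_punctured_nhds]
      exact Filter.not_neBot.1 h
    have := discreteTopology_of_isOpen_singleton_one h1
    exact hG finite_of_compact_of_discrete
  obtain ⟨U, hU, hUd, hUμ⟩ := exists_dense_isOpen_measure_lt μ
  have hev := eventually_measure_diff_eq_zero he hne hU.measurableSet
  obtain ⟨W, hW, hWo, hW1⟩ := eventually_nhds_iff.1 hev
  -- By density, each point can be moved into `U` by some `w` with `w⁻¹` in `W`. Finitely many `w`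
  -- suffice, and each moves only a null part of `Uᶜ` into `U`.
  have hcover : Uᶜ ⊆ ⋃ w : {w : G // w⁻¹ ∈ W}, (fun x => w.1 * x) ⁻¹' U := by
    intro x _
    obtain ⟨y, hy, hyU⟩ := dense_iff_inter_open.1 hUd ((fun y => (y * x⁻¹)⁻¹) ⁻¹' W)
      (hWo.preimage (by fun_prop)) ⟨x, by simpa using hW1⟩
    exact Set.mem_iUnion.2 ⟨⟨y * x⁻¹, hy⟩, by simpa using hyU⟩
  obtain ⟨s, hs⟩ := hU.isClosed_compl.isCompact.elim_finite_subcover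
    (fun w : {w : G // w⁻¹ ∈ W} => (fun x => w.1 * x) ⁻¹' U)
    (fun w => hU.preimage (continuous_const_mul w.1)) hcover
  have h0 : μ Uᶜ = 0 := by
    have h1 : Uᶜ ⊆ ⋃ w ∈ s, {x | x ∉ U ∧ w.1 * x ∈ U} := fun x hx => by
      obtain ⟨w, hw, hxw⟩ := Set.mem_iUnion₂.1 (hs hx)
      exact Set.mem_iUnion₂.2 ⟨w, hw, hx, hxw⟩
    refine measure_mono_null h1 ((measure_biUnion_null_iff s.countable_toSet).2 fun w _ => ?_)
    rw [← hW w.1⁻¹ w.2]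
    refine Eq.trans (congrArg μ ?_) (measure_preimage_mul μ w.1 _)
    ext x
    simp [and_comm]
  rw [measure_compl hU.measurableSet (measure_ne_top μ _), tsub_eq_zero_iff_le] at h0
  exact hUμ.not_ge h0

end CompactGroups

/-! ### Indicator functions with values in `A` -/

section Indicator

variable {G : Type*} [MeasurableSpace G] {μ : Measure G}
  (A : Type*) [NormedAddCommGroup A] [NormedSpace ℂ A]

/-- The bounded operator `a ↦ 1_s a` into `L¹`. -/
def indicatorConstL1 {s : Set G} (hs : MeasurableSet s) (hμs : μ s ≠ ∞) : A →L[ℂ] Lp A 1 μ :=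
  LinearMap.mkContinuous
    { toFun := indicatorConstLp 1 hs hμs
      map_add' := fun a b => indicatorConstLp_add.symm
      map_smul' := fun c a => by
        refine Lp.ext ?_
        filter_upwards [indicatorConstLp_coeFn (p := 1) (hs := hs) (hμs := hμs) (c := c • a),
          indicatorConstLp_coeFn (p := 1) (hs := hs) (hμs := hμs) (c := a),
          Lp.coeFn_smul c (indicatorConstLp 1 hs hμs a)] with x h1 h2 h3
        rw [RingHom.id_apply, h3, Pi.smul_apply, h1, h2]
        by_cases hx : x ∈ s <;> simp [hx] }
    (μ.real s) fun a => by
      refine (norm_indicatorConstLp_le (p := 1) (hs := hs) (hμs := hμs) (c := a)).trans_eq ?_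
      rw [ENNReal.toReal_one, div_one, Real.rpow_one, mul_comm]

end Indicator

/-! ### Finite groups: point masses -/

section Finite

variable {G : Type*} [Group G] [TopologicalSpace G] [IsTopologicalGroup G] [T2Space G]
  [MeasurableSpace G] [BorelSpace G] [Finite G]
  (μ : Measure G) [μ.IsHaarMeasure] [μ.Regular]
  (A : Type*) [NonUnitalNormedRing A] [NormedSpace ℂ A] [IsScalarTower ℂ A A]
  [SMulCommClass ℂ A A] [CompleteSpace A]

theorem measure_singleton_ne_zero_of_finite (t : G) : μ {t} ≠ 0 :=
  ((isOpen_discrete {t}).measure_pos μ (Set.singleton_nonempty t)).ne'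

variable {μ} in
/-- On a finite group classes of functions are functions. -/
theorem Lp_ext_of_finite {f g : Lp A 1 μ} (h : ∀ x, f x = g x) : f = g :=
  Lp.ext (Filter.Eventually.of_forall h)

theorem eq_of_ae_eq_of_finite {E : Type*} {f g : G → E} (h : f =ᵐ[μ] g) (x : G) : f x = g x := by
  by_contra hx
  refine measure_singleton_ne_zero_of_finite μ x (measure_mono_null ?_ h)
  rintro _ rfl
  exact hx

variable {A} in
/-- The element `a` of `A`, placed at the point `t` of a finite group and normalized to have
integral `a`. -/
def pointMassLp (t : G) (a : A) : Lp A 1 μ :=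
  indicatorConstL1 A (measurableSet_singleton t) (measure_ne_top μ _) (((μ.real {t} : ℝ) : ℂ)⁻¹ • a)

variable {A} in
theorem pointMassLp_apply (t : G) (a : A) (x : G) :
    pointMassLp μ t a x = ({t} : Set G).indicator (fun _ => ((μ.real {t} : ℝ) : ℂ)⁻¹ • a) x :=
  eq_of_ae_eq_of_finite μ (indicatorConstLp_coeFn (hs := measurableSet_singleton t)
    (hμs := measure_ne_top μ _)) x

/-- `pointMassLp` as a bounded operator. -/
def pointMassL (t : G) : A →L[ℂ] L1Alg μ A :=
  ((indicatorConstL1 A (measurableSet_singleton t) (measure_ne_top μ _)).comp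
    (((μ.real {t} : ℝ) : ℂ)⁻¹ • ContinuousLinearMap.id ℂ A) : A →L[ℂ] Lp A 1 μ)

/-- Integration over `{s}` cancels the first normalizing factor, and `μ {t} = μ {s * t}` by left
invariance matches the second. -/
theorem pointMassL_mul (s t : G) (a b : A) :
    pointMassL μ A s a * pointMassL μ A t b = pointMassL μ A (s * t) (a * b) := by
  show convL1 (pointMassLp μ s a) (pointMassLp μ t b) = pointMassLp μ (s * t) (a * b)
  have hc (x : G) : ((μ.real {x} : ℝ) : ℂ) ≠ 0 := by
    exact_mod_cast (ENNReal.toReal_pos (measure_singleton_ne_zero_of_finite μ x)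
      (measure_ne_top μ _)).ne'
  have hμ : μ.real {t} = μ.real {s * t} := by
    rw [measureReal_def, measureReal_def, ← measure_preimage_mul μ s⁻¹ {t}]
    congr 2
    ext x
    simp
  have hsmul (r : ℝ) (g : Lp A 1 μ) : r • g = (r : ℂ) • g := (algebraMap_smul ℂ r g).symm
  unfold convL1
  have h1 : (fun r => leftMulL1 (pointMassLp μ s a r) (leftTranslate r (pointMassLp μ t b))) =
      ({s} : Set G).indicator fun _ => ((μ.real {s} : ℝ) : ℂ)⁻¹ •
        leftMulL1 a (leftTranslate s (pointMassLp μ t b)) := by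
    funext r
    rw [pointMassLp_apply]
    by_cases hr : r ∈ ({s} : Set G)
    · have : r = s := hr
      subst this
      simp
    · simp [hr]
  rw [h1, integral_indicator (measurableSet_singleton s), setIntegral_const, hsmul, smul_smul, mul_inv_cancel₀ (hc s), one_smul]
  refine Lp_ext_of_finite A fun x => ?_
  rw [eq_of_ae_eq_of_finite μ (leftMulL1_ae _ _) x, eq_of_ae_eq_of_finite μ (leftTranslate_ae _ _) x,
    pointMassLp_apply, pointMassLp_apply, ← hμ]
  by_cases hx : x = s * t
  · subst hx
    simp [mul_smul_comm]
  · have : s⁻¹ * x ≠ t := fun h => hx (by rw [← h]; group)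
    simp [hx, this]

variable {A} in
theorem exists_sum_pointMassL [Fintype G] (f : L1Alg μ A) :
    f = ∑ t, pointMassL μ A t (setIntegralL μ A {t} f) := by
  let f' : Lp A 1 μ := f
  show f' = ∑ t, pointMassLp μ t (setIntegralL μ A {t} f')
  have hI (t : G) : setIntegralL μ A {t} f' = ((μ.real {t} : ℝ) : ℂ) • f' t := by
    rw [setIntegralL_apply, integral_singleton, Complex.coe_smul]
  simp only [hI]
  refine Lp_ext_of_finite A fun x => ?_
  have hc (x : G) : ((μ.real {x} : ℝ) : ℂ) ≠ 0 := by
    exact_mod_cast (ENNReal.toReal_pos (measure_singleton_ne_zero_of_finite μ x)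
      (measure_ne_top μ _)).ne'
  classical
  have h1 : ((∑ t, pointMassLp μ t (((μ.real {t} : ℝ) : ℂ) • f' t) : Lp A 1 μ) : G → A) x =
      ∑ t, pointMassLp μ t (((μ.real {t} : ℝ) : ℂ) • f' t) x := by
    have := eq_of_ae_eq_of_finite μ (Lp.coeFn_finsetSum Finset.univ
      fun t => pointMassLp μ t (((μ.real {t} : ℝ) : ℂ) • f' t)) x
    rw [this, Finset.sum_apply]
  rw [h1, Finset.sum_eq_single x]
  · rw [pointMassLp_apply, Set.indicator_of_mem (Set.mem_singleton x), smul_smul,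
      inv_mul_cancel₀ (hc x), one_smul]
  · intro t _ htx
    rw [pointMassLp_apply, Set.indicator_of_notMem]
    exact fun h => htx h.symm
  · simp

variable {A} in
/-- On a finite group, `L¹(G, A)` is contractible if `A` is. -/
theorem isContractibleAlgebra_L1Alg_of_finite (hA : IsContractibleAlgebra A) :
    IsContractibleAlgebra (L1Alg μ A) := by
  have := Fintype.ofFinite G
  exact hA.of_finite_group (pointMassL μ A) (pointMassL_mul μ A)
    fun f => ⟨_, exists_sum_pointMassL μ f⟩

variable {A} in
/-- On a finite group, `L¹(G, A)**` is contractible if `A**` is. -/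
theorem isContractibleAlgebra_bidual_L1Alg_of_finite
    (hA : IsContractibleAlgebra (SecondDual A)) :
    IsContractibleAlgebra (SecondDual (L1Alg μ A)) := by
  have := Fintype.ofFinite G
  refine hA.of_finite_group (fun t => bidualMap (pointMassL μ A t))
    (fun s t m n => bidualMap_mul _ _ _ (pointMassL_mul μ A s t) m n) fun m => ?_
  let p : G → L1Alg μ A →L[ℂ] A := fun t => setIntegralL μ A {t}
  refine ⟨fun t => bidualMap (p t) m, SecondDual.ext fun F => ?_⟩
  let m' : StrongDual ℂ (StrongDual ℂ (L1Alg μ A)) := m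
  -- Dualizing the decomposition of the identity of `L¹(G, A)` into projections onto points
  -- decomposes `m` as well.
  have h1 : F = ∑ t, (F.comp (pointMassL μ A t)).comp (p t) := by
    refine ContinuousLinearMap.ext fun f => ?_
    rw [sum_apply]
    conv_lhs => rw [exists_sum_pointMassL μ f, map_sum]
    rfl
  have h2 : (show StrongDual ℂ (StrongDual ℂ (L1Alg μ A)) from
      ∑ t, bidualMap (pointMassL μ A t) (bidualMap (p t) m)) F =
      ∑ t, m' ((F.comp (pointMassL μ A t)).comp (p t)) := by
    let S : SecondDual (L1Alg μ A) →+ ℂ :=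
      { toFun := fun n => (show StrongDual ℂ (StrongDual ℂ (L1Alg μ A)) from n) F
        map_zero' := rfl
        map_add' := fun _ _ => rfl }
    exact map_sum S _ _
  refine Eq.trans ?_ h2.symm
  rw [← map_sum, ← h1]

end Finite

/-! ### Descent to `A` and `A**`, and finiteness of `G` -/

section Main

variable {G : Type*} [Group G] [TopologicalSpace G] [IsTopologicalGroup G]
  [LocallyCompactSpace G] [T2Space G] [MeasurableSpace G] [BorelSpace G]
  {μ : Measure G} [μ.IsHaarMeasure] [μ.Regular]
  {A : Type*} [NonUnitalNormedRing A] [NormedSpace ℂ A] [IsScalarTower ℂ A A]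
  [SMulCommClass ℂ A A] [CompleteSpace A]

variable (μ A) in
/-- Integration `L¹(G, A) → A` has a bounded linear right inverse. -/
theorem exists_section_setIntegralL_univ :
    ∃ σ : A →L[ℂ] L1Alg μ A, ∀ a, setIntegralL μ A Set.univ (σ a) = a := by
  obtain ⟨C, hC, hC1⟩ := exists_compact_mem_nhds (1 : G)
  have hC0 : μ.real C ≠ 0 := (ENNReal.toReal_pos
    (Measure.measure_pos_of_mem_nhds μ hC1).ne' hC.measure_lt_top.ne).ne'
  let σ : A →L[ℂ] L1Alg μ A :=
    (indicatorConstL1 A hC.measurableSet hC.measure_lt_top.ne : A →L[ℂ] Lp A 1 μ)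
  refine ⟨((μ.real C : ℝ) : ℂ)⁻¹ • σ, fun a => ?_⟩
  have h1 : setIntegralL μ A Set.univ (σ a) = ((μ.real C : ℝ) : ℂ) • a := by
    have h2 : σ a = leftTranslate 1 (σ a) := (leftTranslate_one _).symm
    rw [h2]
    refine (setIntegralL_leftTranslate_indicator hC.measurableSet hC.measure_lt_top.ne a 1).trans ?_
    simp
  rw [smul_apply, map_smul, h1, smul_smul, inv_mul_cancel₀ (by exact_mod_cast hC0), one_smul]

/-- `A` is contractible if `L¹(G, A)` is. -/
theorem IsContractibleAlgebra.of_L1Alg (h : IsContractibleAlgebra (L1Alg μ A)) :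
    IsContractibleAlgebra A := by
  obtain ⟨σ, hσ⟩ := exists_section_setIntegralL_univ μ A
  exact h.of_surjective (setIntegralL μ A Set.univ) setIntegralL_univ_mul fun a => ⟨σ a, hσ a⟩

/-- `A**` is contractible if `L¹(G, A)**` is. -/
theorem IsContractibleAlgebra.of_bidual_L1Alg
    (h : IsContractibleAlgebra (SecondDual (L1Alg μ A))) :
    IsContractibleAlgebra (SecondDual A) := by
  obtain ⟨σ, hσ⟩ := exists_section_setIntegralL_univ μ A
  refine h.of_surjective (bidualMap (setIntegralL μ A Set.univ))
    (fun m n => (bidualMap_mul _ _ _ (fun f g => (setIntegralL_univ_mul f g).symm) m n).symm)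
    -- The second adjoint of the section is a section of the second adjoint.
    fun m => ⟨bidualMap σ m, SecondDual.ext fun f => ?_⟩
  refine congrArg (show StrongDual ℂ (StrongDual ℂ A) from m) (ContinuousLinearMap.ext fun a => ?_)
  exact congrArg f (hσ a)

theorem finite_of_bidual_elements {φ : A →L[ℂ] ℂ} (hφ : ∀ a b, φ (a * b) = φ a * φ b)
    (hne : φ ≠ 0) {w e : StrongDual ℂ (StrongDual ℂ (L1Alg μ A))}
    (hw1 : w (φ.comp (setIntegralL μ A Set.univ)) = 1)
    (hw : ∀ m f, w (bidualAct m f) = m (φ.comp (setIntegralL μ A Set.univ)) * w f)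
    (he : ∀ m f, e (bidualAct m f) = m f) : Finite G := by
  have := compactSpace_of_absorbing hφ hne hw1 hw
  exact finite_of_bidual_left_identity he hne

theorem comp_setIntegralL_univ_ne_zero {φ : A →L[ℂ] ℂ} (hne : φ ≠ 0) :
    φ.comp (setIntegralL μ A Set.univ) ≠ 0 := by
  obtain ⟨σ, hσ⟩ := exists_section_setIntegralL_univ μ A
  obtain ⟨x, hx⟩ := DFunLike.ne_iff.1 hne
  refine DFunLike.ne_iff.2 ⟨σ x, ?_⟩
  show φ (setIntegralL μ A Set.univ (σ x)) ≠ 0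
  rwa [hσ]

theorem comp_setIntegralL_univ_mul {φ : A →L[ℂ] ℂ} (hφ : ∀ a b, φ (a * b) = φ a * φ b)
    (f g : L1Alg μ A) : φ.comp (setIntegralL μ A Set.univ) (f * g) =
      φ.comp (setIntegralL μ A Set.univ) f * φ.comp (setIntegralL μ A Set.univ) g := by
  show φ (setIntegralL μ A Set.univ (f * g)) = _
  rw [setIntegralL_univ_mul, hφ]
  rfl

/-- If `A` has a character and `L¹(G, A)` is contractible, then `G` is finite. -/
theorem IsContractibleAlgebra.finite_of_L1Alg (h : IsContractibleAlgebra (L1Alg μ A))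
    {φ : A →L[ℂ] ℂ} (hφ : ∀ a b, φ (a * b) = φ a * φ b) (hne : φ ≠ 0) : Finite G := by
  let J := NormedSpace.inclusionInDoubleDual ℂ (L1Alg μ A)
  obtain ⟨w, hw1, hw⟩ := h.exists_absorbing _ (comp_setIntegralL_univ_mul (μ := μ) hφ)
    (comp_setIntegralL_univ_ne_zero hne)
  obtain ⟨e, he⟩ := h.exists_left_identity
  refine finite_of_bidual_elements (w := J w) (e := J e) hφ hne hw1 (fun m f => ?_) fun m f => ?_
  -- The canonical embedding turns absorption of elements of `L¹` into absorption of every `m`: the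
  -- functional `f · w` is `f w • Φ`, and `m` is evaluated on it.
  · show bidualAct m f w = m _ * f w
    have : dualAct f w = f w • φ.comp (setIntegralL μ A Set.univ) :=
      ContinuousLinearMap.ext fun b => by
        rw [dualAct_apply, hw, map_smul, smul_eq_mul, mul_comm]; rfl
    rw [bidualAct_apply, this, map_smul, smul_eq_mul, mul_comm]
  · show bidualAct m f e = m f
    have : dualAct f e = f := ContinuousLinearMap.ext fun b => by rw [dualAct_apply, he]
    rw [bidualAct_apply, this]

/-- If `A` has a character and `L¹(G, A)**` is contractible, then `G` is finite. -/
theorem IsContractibleAlgebra.finite_of_bidual_L1Alg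
    (h : IsContractibleAlgebra (SecondDual (L1Alg μ A)))
    {φ : A →L[ℂ] ℂ} (hφ : ∀ a b, φ (a * b) = φ a * φ b) (hne : φ ≠ 0) : Finite G := by
  let Φ := φ.comp (setIntegralL μ A Set.univ)
  have hΦ : ∀ f g, Φ (f * g) = Φ f * Φ g := comp_setIntegralL_univ_mul hφ
  have hΦ0 : Φ ≠ 0 := comp_setIntegralL_univ_ne_zero hne
  -- Evaluation at `Φ` is a character of the second dual, as `n · Φ = n Φ • Φ` for every `n`.
  let Ψ : SecondDual (L1Alg μ A) →L[ℂ] ℂ :=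
    NormedSpace.inclusionInDoubleDual ℂ (StrongDual ℂ (L1Alg μ A)) Φ
  have hΨ (m n : SecondDual (L1Alg μ A)) : Ψ (m * n) = Ψ m * Ψ n := by
    let m' : StrongDual ℂ (StrongDual ℂ (L1Alg μ A)) := m
    let n' : StrongDual ℂ (StrongDual ℂ (L1Alg μ A)) := n
    show arensMul m' n' Φ = m' Φ * n' Φ
    have h1 (a : L1Alg μ A) : dualAct Φ a = Φ a • Φ :=
      ContinuousLinearMap.ext fun b => hΦ a b
    have h2 : bidualAct n' Φ = n' Φ • Φ := ContinuousLinearMap.ext fun a => by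
      rw [bidualAct_apply, h1, map_smul, smul_eq_mul, mul_comm]; rfl
    rw [arensMul_apply, h2, map_smul, smul_eq_mul, mul_comm]
  have hΨ0 : Ψ ≠ 0 := by
    obtain ⟨x, hx⟩ := DFunLike.ne_iff.1 hΦ0
    exact DFunLike.ne_iff.2 ⟨NormedSpace.inclusionInDoubleDual ℂ (L1Alg μ A) x, hx⟩
  obtain ⟨w, hw1, hw⟩ := h.exists_absorbing Ψ hΨ hΨ0
  obtain ⟨e, he⟩ := h.exists_left_identity
  exact finite_of_bidual_elements (w := w) (e := e) hφ hne hw1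
    (fun m f => congrArg (fun n : StrongDual ℂ (StrongDual ℂ (L1Alg μ A)) => n f) (hw m))
    fun m f => congrArg (fun n : StrongDual ℂ (StrongDual ℂ (L1Alg μ A)) => n f) (he m)

end Main

end

theorem mainTheorem5 {G : Type*} [Group G] [TopologicalSpace G] [IsTopologicalGroup G]
    [LocallyCompactSpace G] [T2Space G] [MeasurableSpace G] [BorelSpace G]
    (μ : Measure G) [μ.IsHaarMeasure] [μ.Regular]
    {A : Type*} [NonUnitalNormedRing A] [NormedSpace ℂ A] [IsScalarTower ℂ A A]
    [SMulCommClass ℂ A A] [CompleteSpace A] (hA : (WeakDual.characterSpace ℂ A).Nonempty) :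
    (IsContractibleAlgebra (L1Alg μ A) ↔ Finite G ∧ IsContractibleAlgebra A) ∧
    (IsContractibleAlgebra (SecondDual (L1Alg μ A)) ↔
      Finite G ∧ IsContractibleAlgebra (SecondDual A)) := by
  obtain ⟨φ, hne, hφ⟩ := hA
  replace hne : (WeakDual.toStrongDual φ : A →L[ℂ] ℂ) ≠ 0 := hne
  refine ⟨⟨fun h => ⟨h.finite_of_L1Alg hφ hne, h.of_L1Alg⟩, ?_⟩,
    ⟨fun h => ⟨h.finite_of_bidual_L1Alg hφ hne, h.of_bidual_L1Alg⟩, ?_⟩⟩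
  · rintro ⟨hG, h⟩
    exact isContractibleAlgebra_L1Alg_of_finite μ h
  · rintro ⟨hG, h⟩
    exact isContractibleAlgebra_bidual_L1Alg_of_finite μ h
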